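/- Let $N\ge 2$ consumers $\mathcal N=\{1,\dots,N\}$ schedule their energy consumption over $H$ time slots. The feasible set of consumer $n$ is $$\mathcal Q_n=\Big\{x\in\mathbb R^H:\ \sum_{h=1}^H x^h=E_n,\ q_n^{h,\min}\le x^h\le q_n^{h,\max}\ \text{for all } h\Big\},\qquad q_n^{h,\min}\ge 0,$$ and is assumed to be nonempty. The price of a unit of energy in slot $h$ at aggregated load $L\ge 0$ is $p_h(L)=a_hL^{b_h}+c_h$ with $a_h>0$, $b_h\ge 1$, $c_h\ge 0$; for $L<0$ (negative loads can occur only as estimates in the algorithm below) $p_h$ is continued in any way that makes it continuously differentiable on $\mathbb R$. In the game $\mathcal G$ each consumer $n$ chooses $q_n\in\mathcal Q_n$ to minimize the bill $$\mathcal B_n(q_n,q_\Sigma)=\sum_{h=1}^H p_h(q_\Sigma^h)\,q_n^h ,\qquad q_\Sigma=\sum_{m=1}^N q_m .$$ A Nash equilibrium (NE) is a feasible $(q_n)_{n\in\mathcal N}$ in which no consumer can lower the own bill by moving unilaterally within $\mathcal Q_n$. Let $F_n(x,L)\in\mathbb R^H$ be the gradient of consumer $n$'s bill in the own profile (with the other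 consumers' load $L-x$ held fixed) at own profile $x$ and aggregated load $L$, that is, $F_n(x,L)^h=p_h'(L^h)\,x^h+p_h(L^h)$. Let an undirected graph on $\mathcal N$ be given, and let the consumers have independent Poisson clocks of rate $1$. At each tick of the own clock a consumer contacts one of the own neighbours, chosen uniformly at random, independently of the clocks and of all other choices. For $t=1,2,\dots$ let $I^t$ be the consumer whose clock produces the $t$-th tick among all ticks of all clocks, and $J^t$ the neighbour contacted at that tick. The asynchronous gossip algorithm starts at an arbitrary feasible $q(1)=(q_n(1))_n$ with $\hat q_n(1)=q_n(1)$, and at time $t$ each $n\in\{I^t,J^t\}$ executes $$\bar q(t)=\tfrac12\big(\hat q_{I^t}(t)+\hat q_{J^t}(t)\big),\quad q_n(t+1)=\Big[q_n(t)-\tfrac1{\epsilon_n(t)}F_n\big(q_n(t),N\bar q(t)\big)\Big]_{\mathcal Q_n},\quad \hat q_n(t+1)=\bar q(t)+q_n(t+1)-q_n(t),$$ where $[\,\cdot\,]_{\mathcal Q_n}$ is the Euclidean projection onto $\mathcal Q_n$ and $\epsilon_n(t)$ is the number of updates executed by consumer $n$ up to time $t$ inclusively; the other consumers keep $q_n$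 and $\hat q_n$ unchanged. Assume that the graph is connected and that $b_h<3+\frac{4}{N-1}$ for every $h$. Then $\mathcal G$ has a unique NE, and the sequence $q(t)$ generated by the algorithm converges to it almost surely. -/

import Mathlib

open MeasureTheory ProbabilityTheory Filter Topology

namespace LoadSched

/-- Data of the energy scheduling game with `N` consumers and `H` time slots: the price of one unit
of energy in each slot as a function of the aggregated load, the minimum and maximum energy levels
of each consumer in each slot, and the total energy requirement of each consumer. -/
structure Game (N H : ℕ) where
  price : Fin H → ℝ → ℝ
  lo : Fin N → Fin H → ℝ
  hi : Fin N → Fin H → ℝ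
  total : Fin N → ℝ

namespace Game

variable {N H : ℕ}

/-- The feasible set of consumer `n`. -/
def actionSet (g : Game N H) (n : Fin N) : Set (EuclideanSpace ℝ (Fin H)) :=
  {x | ∑ h, x h = g.total n ∧ ∀ h, g.lo n h ≤ x h ∧ x h ≤ g.hi n h}

/-- The energy bill of a consumer whose profile is `x` when the aggregated load is `L`. -/
noncomputable def bill (g : Game N H) (x L : EuclideanSpace ℝ (Fin H)) : ℝ :=
  ∑ h, g.price h (L h) * x h

/-- `q` is a Nash equilibrium: it is feasible, and no consumer can lower the own bill by moving
unilaterally to another feasible profile (the aggregated load moves along). -/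
def IsNash (g : Game N H) (q : Fin N → EuclideanSpace ℝ (Fin H)) : Prop :=
  (∀ n, q n ∈ g.actionSet n) ∧
    ∀ n, ∀ x ∈ g.actionSet n,
      g.bill (q n) (∑ m, q m) ≤ g.bill x (∑ m, Function.update q n x m)

/-- The gradient of a consumer's bill with respect to the own profile, at profile `x` and aggregated
load `L`; the load of the other consumers, `L - x`, is held fixed. -/
noncomputable def billGrad (g : Game N H) (x L : EuclideanSpace ℝ (Fin H)) :
    EuclideanSpace ℝ (Fin H) :=
  gradient (fun y => g.bill y (L - x + y)) x

end Game

/-- A Euclidean projection of `x` onto `K`: a point of `K` nearest to `x` (unique if `K` is nonempty,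
closed and convex). -/
noncomputable def proj {H : ℕ} (K : Set (EuclideanSpace ℝ (Fin H))) (x : EuclideanSpace ℝ (Fin H)) :
    EuclideanSpace ℝ (Fin H) :=
  Classical.epsilon fun y => y ∈ K ∧ ∀ z ∈ K, dist x y ≤ dist x z

/-- The number of updates of consumer `n` at the times `0, …, t` (inclusively) if the pair
`pr s` updates at time `s`. -/
def updateCount {N : ℕ} (pr : ℕ → Fin N × Fin N) (n : Fin N) (t : ℕ) : ℕ :=
  ((Finset.range (t + 1)).filter fun s => n = (pr s).1 ∨ n = (pr s).2).card

/-- The gossip algorithm driven by the sequence of pairs `pr`, started at `q₀`. The state at time `t`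
consists of the energy profiles of all consumers and of their estimates of the average profile.
Time starts at `0`. -/
noncomputable def gossip {N H : ℕ} (g : Game N H) (q₀ : Fin N → EuclideanSpace ℝ (Fin H))
    (pr : ℕ → Fin N × Fin N) :
    ℕ → (Fin N → EuclideanSpace ℝ (Fin H)) × (Fin N → EuclideanSpace ℝ (Fin H))
  | 0 => (q₀, q₀)
  | t + 1 =>
    let q := (gossip g q₀ pr t).1
    let v := (gossip g q₀ pr t).2
    let avg := (1 / 2 : ℝ) • (v (pr t).1 + v (pr t).2)
    let q' : Fin N → EuclideanSpace ℝ (Fin H) := fun n =>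
      if n = (pr t).1 ∨ n = (pr t).2 then
        proj (g.actionSet n)
          (q n - (1 / (updateCount pr n t : ℝ)) • g.billGrad (q n) ((N : ℝ) • avg))
      else q n
    let v' : Fin N → EuclideanSpace ℝ (Fin H) := fun n =>
      if n = (pr t).1 ∨ n = (pr t).2 then avg + q' n - q n else v n
    (q', v')

/-- The random input of the gossip protocol on the graph `G`. Every consumer `n` has a Poisson clock
of rate `1`, given by its i.i.d. exponential waiting times `τ n 0, τ n 1, …`, and at the `k`-th tick
of the clock (`k = 0, 1, …`) the consumer contacts the neighbour `κ n k`, uniformly distributed among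
all neighbours. All these random variables are independent. -/
structure IsGossipInput {N : ℕ} (G : SimpleGraph (Fin N)) {Ω : Type*} [MeasurableSpace Ω]
    (μ : Measure Ω) (τ : Fin N → ℕ → Ω → ℝ) (κ : Fin N → ℕ → Ω → Fin N) : Prop where
  measurable_wait : ∀ n k, Measurable (τ n k)
  measurable_contact : ∀ n k, Measurable (κ n k)
  wait_law : ∀ n k, μ.map (τ n k) = expMeasure 1
  contact_law : ∀ n k, μ.map (κ n k) = uniformOn (G.neighborSet n)
  indep_ticks : iIndepFun (fun (p : Fin N × ℕ) ω => (τ p.1 p.2 ω, κ p.1 p.2 ω)) μ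
  indep_wait_contact : ∀ n k, IndepFun (τ n k) (κ n k) μ

/-- The time of tick `p = (n, k)`, the `k`-th tick (`k = 0, 1, …`) of the clock of consumer `n`, for
waiting times `w`. -/
def tickTime {N : ℕ} (w : Fin N → ℕ → ℝ) (p : Fin N × ℕ) : ℝ :=
  ∑ k ∈ Finset.range (p.2 + 1), w p.1 k

/-- `σ 0, σ 1, …` lists all ticks of all clocks, in the order of time. -/
def IsTickOrder {N : ℕ} (w : Fin N → ℕ → ℝ) (σ : ℕ → Fin N × ℕ) : Prop :=
  StrictMono (fun t => tickTime w (σ t)) ∧ Function.Surjective σ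

end LoadSched

/-! Each bill is convex in the own profile, so a feasible profile is a Nash equilibrium exactly when
it solves the variational inequality of `pseudoGrad` (`isNash_iff`). The bound on `b h` makes
`pseudoGrad` strictly monotone on the feasible set: along a segment with direction `v`, its pairing
with `v` has in every slot a derivative that is a positive multiple of a nonnegative combination of
the forms in `quadratic_pos`, and `b < 3 + 4 / (N - 1)` is what keeps these forms positive.
Monotonicity and compactness give existence, strictness gives uniqueness.

Randomness enters the convergence only through `HasFrequencies`, which holds almost surely by the
strong law of large numbers; everything after it is deterministic (`tendsto_gossip`). A consumer
with asymptotic update frequency `p` has step sizes 1, 1/2, 1/3, ..., whose sum up to time `t` is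
`log t` plus a convergent term. Hence in a window from `t` to about `exp δ * t` every consumer
accumulates a total step size close to `δ`, whatever the own frequency: in logarithmic time all
consumers move at the same speed. Moreover, every edge is used in every late window.

This has two consequences. First, in a window the gradient steps perturb the estimates by `O(δ)`
only, with `δ` as small as desired, while all edges still get averaged; so the estimates reach
consensus (`tendsto_consensus`). Their sum always equals the sum of the profiles, hence `N` times
the exchanged average approaches the true aggregated load. Second, up to vanishing errors, the
squared distance to the equilibrium drops at each update of `n` by the step size times `2 ⟪F n, x n
- q n⟫`. A single such term may have the wrong sign; only the sum over `n` is positive, and the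
equal weights in a window make this sum appear (`tendsto_zero_of_averaged_descent`). -/

namespace LoadSched

open scoped RealInnerProductSpace

/-! ### Gradients of the bills and the feasible sets -/

namespace Game

variable {N H : ℕ}

lemma hasGradientAt_bill (g : Game N H) (hp : ∀ h, Differentiable ℝ (g.price h))
    (R x : EuclideanSpace ℝ (Fin H)) :
    HasGradientAt (fun y => g.bill y (R + y))
      (WithLp.toLp 2 fun h => deriv (g.price h) (R h + x h) * x h + g.price h (R h + x h)) x := by
  rw [hasGradientAt_iff_hasFDerivAt]
  have key : ∀ h : Fin H, HasFDerivAt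
      (fun y : EuclideanSpace ℝ (Fin H) => g.price h ((R + y) h) * y h)
      ((g.price h (R h + x h)) • (EuclideanSpace.proj h : EuclideanSpace ℝ (Fin H) →L[ℝ] ℝ) +
        (x h) • (deriv (g.price h) (R h + x h) •
          (EuclideanSpace.proj h : EuclideanSpace ℝ (Fin H) →L[ℝ] ℝ))) x := by
    intro h
    have h1 : HasFDerivAt (fun y : EuclideanSpace ℝ (Fin H) => y h)
        (EuclideanSpace.proj h : EuclideanSpace ℝ (Fin H) →L[ℝ] ℝ) x :=
      (EuclideanSpace.proj h : EuclideanSpace ℝ (Fin H) →L[ℝ] ℝ).hasFDerivAt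
    have h2 : HasFDerivAt (fun y : EuclideanSpace ℝ (Fin H) => (R + y) h)
        (EuclideanSpace.proj h : EuclideanSpace ℝ (Fin H) →L[ℝ] ℝ) x := by
      simpa using h1.const_add (R h)
    have h3 : HasDerivAt (g.price h) (deriv (g.price h) (R h + x h)) ((R + x) h) :=
      (hp h _).hasDerivAt
    exact (h3.comp_hasFDerivAt x h2).mul h1
  have hs := HasFDerivAt.fun_sum (u := Finset.univ) fun h _ => key h
  refine hs.congr_fderiv ?_
  ext y
  simp only [_root_.sum_apply, InnerProductSpace.toDual_apply_apply,
    PiLp.inner_apply, _root_.add_apply, _root_.smul_apply,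
    smul_eq_mul, RCLike.inner_apply, conj_trivial]
  refine Finset.sum_congr rfl fun h _ => ?_
  have hpr : (EuclideanSpace.proj h : EuclideanSpace ℝ (Fin H) →L[ℝ] ℝ) y = y h := rfl
  rw [hpr]
  ring

lemma billGrad_apply (g : Game N H) (hp : ∀ h, Differentiable ℝ (g.price h))
    (x L : EuclideanSpace ℝ (Fin H)) (h : Fin H) :
    g.billGrad x L h = deriv (g.price h) (L h) * x h + g.price h (L h) := by
  rw [billGrad, (g.hasGradientAt_bill hp (L - x) x).gradient]
  simp

lemma continuous_billGrad (g : Game N H) (hs : ∀ h, ContDiff ℝ 1 (g.price h)) :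
    Continuous fun z : EuclideanSpace ℝ (Fin H) × EuclideanSpace ℝ (Fin H) =>
      g.billGrad z.1 z.2 := by
  have hd : ∀ h, Continuous (deriv (g.price h)) := fun h => (hs h).continuous_deriv le_rfl
  have hc : ∀ h, Continuous (g.price h) := fun h => (hs h).continuous
  have : (fun z : EuclideanSpace ℝ (Fin H) × EuclideanSpace ℝ (Fin H) => g.billGrad z.1 z.2) =
      fun z => WithLp.toLp 2 fun h =>
        deriv (g.price h) (z.2 h) * z.1 h + g.price h (z.2 h) := by
    ext z h
    exact g.billGrad_apply (fun h => (hs h).differentiable (by norm_num)) z.1 z.2 h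
  rw [this]
  refine (PiLp.continuous_toLp 2 _).comp (continuous_pi fun h => ?_)
  have := hd h
  have := hc h
  fun_prop

lemma actionSet_eq_inter (g : Game N H) (n : Fin N) :
    g.actionSet n = {x | ∑ h, x h = g.total n} ∩ ⋂ h, {x | g.lo n h ≤ x h ∧ x h ≤ g.hi n h} := by
  ext x; simp [actionSet]

lemma isClosed_actionSet (g : Game N H) (n : Fin N) : IsClosed (g.actionSet n) := by
  rw [actionSet_eq_inter]
  refine (isClosed_eq (by fun_prop) continuous_const).inter (isClosed_iInter fun h => ?_)
  have hc : Continuous fun x : EuclideanSpace ℝ (Fin H) => x h := by fun_prop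
  exact (isClosed_le continuous_const hc).inter (isClosed_le hc continuous_const)

lemma convex_actionSet (g : Game N H) (n : Fin N) : Convex ℝ (g.actionSet n) := by
  rintro x ⟨hx, hx'⟩ y ⟨hy, hy'⟩ a b ha hb hab
  refine ⟨?_, fun h => ⟨?_, ?_⟩⟩
  · simp only [PiLp.add_apply, PiLp.smul_apply, smul_eq_mul, Finset.sum_add_distrib,
      ← Finset.mul_sum, hx, hy, ← add_mul, hab, one_mul]
  · simp only [PiLp.add_apply, PiLp.smul_apply, smul_eq_mul]
    calc g.lo n h = a * g.lo n h + b * g.lo n h := by rw [← add_mul, hab, one_mul]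
      _ ≤ _ := add_le_add (mul_le_mul_of_nonneg_left (hx' h).1 ha)
        (mul_le_mul_of_nonneg_left (hy' h).1 hb)
  · simp only [PiLp.add_apply, PiLp.smul_apply, smul_eq_mul]
    calc _ ≤ a * g.hi n h + b * g.hi n h := add_le_add (mul_le_mul_of_nonneg_left (hx' h).2 ha)
          (mul_le_mul_of_nonneg_left (hy' h).2 hb)
      _ = g.hi n h := by rw [← add_mul, hab, one_mul]

lemma isCompact_actionSet (g : Game N H) (n : Fin N) : IsCompact (g.actionSet n) := by
  have hK : IsCompact ((WithLp.toLp 2 : (Fin H → ℝ) → EuclideanSpace ℝ (Fin H)) ''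
      Set.Icc (g.lo n) (g.hi n)) := isCompact_Icc.image (PiLp.continuous_toLp 2 _)
  refine hK.of_isClosed_subset (g.isClosed_actionSet n) ?_
  rintro x ⟨-, hx⟩
  exact ⟨fun h => x h, ⟨fun h => (hx h).1, fun h => (hx h).2⟩, rfl⟩

/-- The set of feasible profiles of all consumers. -/
def feasible (g : Game N H) : Set (Fin N → EuclideanSpace ℝ (Fin H)) :=
  Set.univ.pi g.actionSet

lemma mem_feasible {g : Game N H} {q : Fin N → EuclideanSpace ℝ (Fin H)} :
    q ∈ g.feasible ↔ ∀ n, q n ∈ g.actionSet n := by simp [feasible]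

lemma isCompact_feasible (g : Game N H) : IsCompact g.feasible :=
  isCompact_univ_pi g.isCompact_actionSet

lemma convex_feasible (g : Game N H) : Convex ℝ g.feasible :=
  convex_pi fun n _ => g.convex_actionSet n

/-- The gradients of the bills of all consumers at the profiles `q`. -/
noncomputable def pseudoGrad (g : Game N H) (q : Fin N → EuclideanSpace ℝ (Fin H)) (n : Fin N) :
    EuclideanSpace ℝ (Fin H) :=
  g.billGrad (q n) (∑ m, q m)

lemma continuous_pseudoGrad (g : Game N H) (hs : ∀ h, ContDiff ℝ 1 (g.price h)) :
    Continuous g.pseudoGrad :=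
  continuous_pi fun n => (g.continuous_billGrad hs).comp
    (f := fun q : Fin N → EuclideanSpace ℝ (Fin H) => (q n, ∑ m, q m)) (by fun_prop)

end Game

/-! ### Strict monotonicity of the pseudo-gradient -/

/-- With `V = ∑ v` and `k = 1 / (N - 1)`, Cauchy–Schwarz for the indices other than `n` bounds the
form below by `(1 + k) (V² + (v n)²) + (b - 1 - 2k) V (v n)`. This binary form is positive definite
iff `|b - 1 - 2k| < 2 (1 + k)`, that is, `-1 < b < 3 + 4k`. -/
lemma quadratic_pos {N : ℕ} (hN : 2 ≤ N) {b : ℝ} (hb : 1 ≤ b) (hb' : b < 3 + 4 / ((N : ℝ) - 1))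
    {v : Fin N → ℝ} (hv : v ≠ 0) (n : Fin N) :
    0 < (b - 1) * (∑ m, v m) * v n + ∑ m, v m ^ 2 + (∑ m, v m) ^ 2 := by
  have hN' : (0 : ℝ) < (N : ℝ) - 1 := by
    have : (2 : ℝ) ≤ N := by exact_mod_cast hN
    linarith
  have hsum : ∑ m, v m = v n + ∑ m ∈ Finset.univ.erase n, v m :=
    (Finset.add_sum_erase _ _ (Finset.mem_univ n)).symm
  have hsq : ∑ m, v m ^ 2 = v n ^ 2 + ∑ m ∈ Finset.univ.erase n, v m ^ 2 :=
    (Finset.add_sum_erase _ (fun m => v m ^ 2) (Finset.mem_univ n)).symm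
  have hcs := sq_sum_le_card_mul_sum_sq (s := Finset.univ.erase n) (f := v)
  have hcard : (((Finset.univ.erase n).card : ℕ) : ℝ) = (N : ℝ) - 1 := by
    rw [Finset.card_erase_of_mem (Finset.mem_univ n), Finset.card_univ, Fintype.card_fin,
      Nat.cast_sub (by omega)]
    simp
  rw [hcard] at hcs
  have hpos : 0 < ∑ m, v m ^ 2 := by
    obtain ⟨i, hi⟩ := Function.ne_iff.1 hv
    exact Finset.sum_pos' (fun _ _ => sq_nonneg _) ⟨i, Finset.mem_univ _, by
      have : v i ≠ 0 := hi
      positivity⟩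
  set V := ∑ m, v m with hV
  set w := ∑ m ∈ Finset.univ.erase n, v m with hw
  set K := (N : ℝ) - 1 with hK
  have hq : (V - v n) ^ 2 / K ≤ ∑ m ∈ Finset.univ.erase n, v m ^ 2 := by
    rw [div_le_iff₀ hN']
    have : V - v n = w := by rw [hsum]; ring
    rw [this]; linarith
  have hdiv : (V - v n) ^ 2 / K = (V ^ 2 - 2 * V * v n + v n ^ 2) * (1 / K) := by ring
  set k := 1 / K with hk
  have hk0 : 0 < k := by positivity
  have hbk : b < 3 + 4 * k := by rw [hk]; convert hb' using 2; ring
  by_cases h0 : V = 0 ∧ v n = 0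
  · rw [h0.1]; simpa using hpos
  · have hp : 0 < V ^ 2 + v n ^ 2 := by
      by_contra hcon
      apply h0
      constructor <;> nlinarith [sq_nonneg V, sq_nonneg (v n)]
    have hlow : v n ^ 2 * (1 + k) + V ^ 2 * (1 + k) + (b - 1 - 2 * k) * (V * v n) ≤
        (b - 1) * V * v n + ∑ m, v m ^ 2 + V ^ 2 := by
      rw [hsq]
      nlinarith [hq, hdiv]
    refine lt_of_lt_of_le ?_ hlow
    have h1 : 0 < 3 + 4 * k - b := by linarith
    have h2 : 0 < b + 1 := by linarith
    rcases le_total 0 (V * v n) with h | h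
    · nlinarith [sq_nonneg (V - v n), sq_nonneg (V + v n), mul_nonneg h h2.le, mul_pos hk0 hp]
    · have e : v n ^ 2 * (1 + k) + V ^ 2 * (1 + k) + (b - 1 - 2 * k) * (V * v n) =
        (1 + k) * (V + v n) ^ 2 + (3 + 4 * k - b) * (-(V * v n)) := by ring
      rw [e]
      rcases h.lt_or_eq with h' | h'
      · have : 0 < (3 + 4 * k - b) * (-(V * v n)) := mul_pos h1 (by linarith)
        positivity
      · rw [h']
        have : (V + v n) ^ 2 = V ^ 2 + v n ^ 2 := by nlinarith
        rw [this]; positivity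

/-- Differentiation within `[0, ∞)` determines the derivative even at load `0`, whatever the
continuation of the price to negative loads. -/
lemma deriv_price_eq {a b c : ℝ} (hb : 1 ≤ b) {p : ℝ → ℝ}
    (hp : ∀ L : ℝ, 0 ≤ L → p L = a * L ^ b + c) (hs : ContDiff ℝ 1 p) {L : ℝ} (hL : 0 ≤ L) :
    deriv p L = a * (b * L ^ (b - 1)) := by
  have h1 : HasDerivWithinAt p (deriv p L) (Set.Ici 0) L :=
    ((hs.differentiable (by norm_num)) L).hasDerivAt.hasDerivWithinAt
  have h2 : HasDerivWithinAt p (a * (b * L ^ (b - 1))) (Set.Ici 0) L := by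
    refine HasDerivWithinAt.congr ?_ (fun y hy => hp y hy) (hp L hL)
    exact (((Real.hasDerivAt_rpow_const (Or.inr hb)).const_mul a).add_const c).hasDerivWithinAt
  exact (uniqueDiffOn_Ici (0 : ℝ) L hL).eq_deriv _ h1 h2

lemma price_monotone_along {N : ℕ} (hN : 2 ≤ N) {a b c : ℝ} (ha : 0 < a) (hb : 1 ≤ b)
    (hb' : b < 3 + 4 / ((N : ℝ) - 1)) {p : ℝ → ℝ}
    (hp : ∀ L : ℝ, 0 ≤ L → p L = a * L ^ b + c) (hs : ContDiff ℝ 1 p)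
    {x y : Fin N → ℝ} (hx : ∀ n, 0 ≤ x n) (hy : ∀ n, 0 ≤ y n) (hxy : x ≠ y) :
    0 < ∑ n, ((deriv p (∑ m, x m) * x n + p (∑ m, x m)) -
      (deriv p (∑ m, y m) * y n + p (∑ m, y m))) * (x n - y n) := by
  set v : Fin N → ℝ := fun n => x n - y n with hv
  have hv0 : v ≠ 0 := fun h => hxy (funext fun n => sub_eq_zero.1 (congrFun h n))
  set z : ℝ → Fin N → ℝ := fun s n => y n + s * v n with hz
  set L : ℝ → ℝ := fun s => ∑ m, z s m with hL
  set V : ℝ := ∑ n, v n with hV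
  have hz0 : ∀ s ∈ Set.Icc (0 : ℝ) 1, ∀ n, 0 ≤ z s n := by
    intro s hs n
    have : z s n = (1 - s) * y n + s * x n := by simp only [hz, hv]; ring
    rw [this]
    exact add_nonneg (mul_nonneg (by linarith [hs.2]) (hy n)) (mul_nonneg hs.1 (hx n))
  have hLpos : ∀ s ∈ Set.Ioo (0 : ℝ) 1, 0 < L s := by
    intro s hs
    obtain ⟨i, hi⟩ := Function.ne_iff.1 hxy
    refine Finset.sum_pos' (fun n _ => hz0 s (Set.Ioo_subset_Icc_self hs) n)
      ⟨i, Finset.mem_univ _, ?_⟩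
    have e : z s i = (1 - s) * y i + s * x i := by simp only [hz, hv]; ring
    rw [e]
    have h1 : 0 < 1 - s := by linarith [hs.2]
    have h0 := hs.1
    rcases (hx i).lt_or_eq with h | h
    · have := hy i; positivity
    · have hyi : 0 < y i := lt_of_le_of_ne (hy i) (fun h' => hi (by rw [← h, ← h']))
      have := hx i; positivity
  set φ : ℝ → ℝ := fun s => deriv p (L s) * (∑ n, z s n * v n) + p (L s) * V with hφ
  have hcont : Continuous φ := by
    have h1 : Continuous (deriv p) := hs.continuous_deriv le_rfl
    have h2 : Continuous p := hs.continuous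
    simp only [hφ, hL, hz]
    fun_prop
  have hderiv : ∀ s ∈ Set.Ioo (0 : ℝ) 1, 0 < deriv φ s := by
    intro s hs'
    have hLs := hLpos s hs'
    have hev : φ =ᶠ[𝓝 s] fun r => a * (b * (L r) ^ (b - 1)) * (∑ n, z r n * v n) +
        (a * (L r) ^ b + c) * V := by
      filter_upwards [Ioo_mem_nhds hs'.1 hs'.2] with r hr
      have hr0 := (hLpos r hr).le
      simp only [hφ]
      rw [deriv_price_eq hb hp hs hr0, hp _ hr0]
    rw [hev.deriv_eq]
    have hdz : ∀ n, HasDerivAt (fun r => z r n) (v n) s := fun n => by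
      simpa only [id, one_mul] using ((hasDerivAt_id s).mul_const (v n)).const_add (y n)
    have hdL : HasDerivAt L V s := by
      simpa using HasDerivAt.fun_sum (u := Finset.univ) fun n _ => hdz n
    have hdS : HasDerivAt (fun r => ∑ n, z r n * v n) (∑ n, v n * v n) s :=
      HasDerivAt.fun_sum (u := Finset.univ) fun n _ => (hdz n).mul_const (v n)
    have hd1 := ((hdL.rpow_const (p := b - 1) (Or.inl hLs.ne')).const_mul b).const_mul a
    have hd2 := ((hdL.rpow_const (p := b) (Or.inl hLs.ne')).const_mul a).add_const c
    have hd := (hd1.mul hdS).add (hd2.mul_const V)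
    have hd' : HasDerivAt (fun r => a * (b * (L r) ^ (b - 1)) * (∑ n, z r n * v n) +
        (a * (L r) ^ b + c) * V) _ s := hd
    rw [hd'.deriv]
    have hpow : L s ^ (b - 1) = L s ^ (b - 1 - 1) * L s := by
      rw [Real.rpow_sub_one hLs.ne' (b - 1)]; field_simp
    -- The derivative of `φ` at `s` equals `a * b * L ^ (b - 2)` times this sum. The weights `z s n`
    -- are nonnegative and add up to `L s > 0`.
    have hbr : 0 < ∑ n, z s n * ((b - 1) * V * v n + ∑ m, v m ^ 2 + V ^ 2) := by
      have hnn : ∀ n, 0 ≤ z s n := hz0 s (Set.Ioo_subset_Icc_self hs')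
      have hq := fun n => quadratic_pos hN hb hb' hv0 n
      obtain ⟨i, hi⟩ : ∃ i, 0 < z s i := by
        by_contra hcon
        push Not at hcon
        exact hLs.not_ge (Finset.sum_nonpos fun n _ => hcon n)
      exact Finset.sum_pos' (fun n _ => mul_nonneg (hnn n) (hq n).le)
        ⟨i, Finset.mem_univ _, mul_pos hi (hq i)⟩
    have hexp : ∑ n, z s n * ((b - 1) * V * v n + ∑ m, v m ^ 2 + V ^ 2) =
        (b - 1) * V * (∑ n, z s n * v n) + L s * (∑ n, v n * v n + V ^ 2) := by
      have e1 : ∑ n, v n * v n = ∑ m, v m ^ 2 := Finset.sum_congr rfl fun n _ => by ring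
      rw [e1, Finset.mul_sum Finset.univ (fun n => z s n * v n)]
      simp only [hL]
      rw [Finset.sum_mul, ← Finset.sum_add_distrib]
      exact Finset.sum_congr rfl fun n _ => by ring
    rw [hexp] at hbr
    rw [hpow]
    have hP : 0 < L s ^ (b - 1 - 1) := Real.rpow_pos_of_pos hLs _
    have := mul_pos (mul_pos (mul_pos ha (by linarith : 0 < b)) hP) hbr
    refine this.trans_eq ?_
    ring
  -- At the endpoints the load may vanish and `L ^ (b - 2)` may be singular; there continuity of `φ`
  -- suffices.
  have hmono : StrictMonoOn φ (Set.Icc 0 1) := by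
    refine strictMonoOn_of_deriv_pos (convex_Icc 0 1) hcont.continuousOn ?_
    rw [interior_Icc]
    exact hderiv
  have h01 := hmono (Set.left_mem_Icc.2 zero_le_one) (Set.right_mem_Icc.2 zero_le_one) zero_lt_one
  have e0 : z 0 = y := by funext n; simp [hz]
  have e1 : z 1 = x := by funext n; simp [hz, hv]
  have e : ∑ n, ((deriv p (∑ m, x m) * x n + p (∑ m, x m)) -
      (deriv p (∑ m, y m) * y n + p (∑ m, y m))) * (x n - y n) = φ 1 - φ 0 := by
    simp only [hφ, hL, e0, e1, hV, Finset.mul_sum, ← Finset.sum_add_distrib,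
      ← Finset.sum_sub_distrib]
    exact Finset.sum_congr rfl fun n _ => by simp only [hv]; ring
  rw [e]; linarith

namespace Game

variable {N H : ℕ}

lemma pseudoGrad_strictMono (hN : 2 ≤ N) {a b c : Fin H → ℝ} (ha : ∀ h, 0 < a h)
    (hb : ∀ h, 1 ≤ b h) (g : Game N H)
    (hprice : ∀ h, ∀ L : ℝ, 0 ≤ L → g.price h L = a h * L ^ b h + c h)
    (hsmooth : ∀ h, ContDiff ℝ 1 (g.price h)) (hlo : ∀ n h, 0 ≤ g.lo n h)
    (hb' : ∀ h, b h < 3 + 4 / ((N : ℝ) - 1))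
    {x y : Fin N → EuclideanSpace ℝ (Fin H)} (hx : x ∈ g.feasible) (hy : y ∈ g.feasible)
    (hxy : x ≠ y) :
    0 < ∑ n, ⟪g.pseudoGrad x n - g.pseudoGrad y n, x n - y n⟫ := by
  have hd : ∀ h, Differentiable ℝ (g.price h) := fun h => (hsmooth h).differentiable (by norm_num)
  have hx0 : ∀ h n, 0 ≤ x n h := fun h n => (hlo n h).trans ((mem_feasible.1 hx n).2 h).1
  have hy0 : ∀ h n, 0 ≤ y n h := fun h n => (hlo n h).trans ((mem_feasible.1 hy n).2 h).1
  have e : ∑ n, ⟪g.pseudoGrad x n - g.pseudoGrad y n, x n - y n⟫ =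
      ∑ h, ∑ n, ((deriv (g.price h) (∑ m, x m h) * x n h + g.price h (∑ m, x m h)) -
      (deriv (g.price h) (∑ m, y m h) * y n h + g.price h (∑ m, y m h))) * (x n h - y n h) := by
    rw [Finset.sum_comm]
    refine Finset.sum_congr rfl fun n _ => ?_
    rw [PiLp.inner_apply]
    refine Finset.sum_congr rfl fun h _ => ?_
    simp only [pseudoGrad, PiLp.sub_apply, g.billGrad_apply hd, RCLike.inner_apply, conj_trivial,
      WithLp.ofLp_sum, Finset.sum_apply]
    ring
  rw [e]
  have hpos : ∀ h, (fun n => x n h) ≠ (fun n => y n h) → 0 < ∑ n,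
      ((deriv (g.price h) (∑ m, x m h) * x n h + g.price h (∑ m, x m h)) -
      (deriv (g.price h) (∑ m, y m h) * y n h + g.price h (∑ m, y m h))) * (x n h - y n h) :=
    fun h hne => price_monotone_along hN (ha h) (hb h) (hb' h) (hprice h) (hsmooth h)
      (hx0 h) (hy0 h) hne
  obtain ⟨n, hn⟩ := Function.ne_iff.1 hxy
  obtain ⟨h, hh⟩ : ∃ h, x n h ≠ y n h := by
    by_contra hcon
    push Not at hcon
    exact hn (PiLp.ext hcon)
  refine Finset.sum_pos' (fun h' _ => ?_) ⟨h, Finset.mem_univ _, hpos h fun e => hh (congrFun e n)⟩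
  by_cases heq : (fun n => x n h') = (fun n => y n h')
  · have h1 : ∀ n, x n h' = y n h' := congrFun heq
    simp [h1]
  · exact (hpos h' heq).le

end Game

/-! ### Monotone variational inequalities -/

/-- In the matrix game `A` the value is at most the payoff when both players use the same mixed
strategy, and that payoff only sees the symmetric part of `A`, which is nonpositive. An optimal
strategy of the minimizer is therefore a suitable `l`. -/
lemma exists_mem_stdSimplex_forall_sum_le_zero {ι : Type*} [Fintype ι] [Nonempty ι]
    (A : ι → ι → ℝ) (hA : ∀ i j, A i j + A j i ≤ 0) :
    ∃ l ∈ stdSimplex ℝ ι, ∀ i, ∑ j, l j * A i j ≤ 0 := by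
  classical
  let f : (ι → ℝ) → (ι → ℝ) → ℝ := fun l m => ∑ i, ∑ j, m i * (l j * A i j)
  have hne : (stdSimplex ℝ ι).Nonempty := ⟨_, single_mem_stdSimplex ℝ (Classical.arbitrary ι)⟩
  have hlin1 : ∀ m, ∃ φ : (ι → ℝ) →ₗ[ℝ] ℝ, (fun l => f l m) = φ := fun m =>
    ⟨{ toFun := fun l => f l m
       map_add' := fun x y => by
         simp only [f, Pi.add_apply, add_mul, mul_add, Finset.sum_add_distrib]
       map_smul' := fun c x => by
         simp only [f, Pi.smul_apply, smul_eq_mul, RingHom.id_apply, Finset.mul_sum]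
         exact Finset.sum_congr rfl fun i _ => Finset.sum_congr rfl fun j _ => by ring }, rfl⟩
  have hlin2 : ∀ l, ∃ φ : (ι → ℝ) →ₗ[ℝ] ℝ, (fun m => f l m) = φ := fun l =>
    ⟨{ toFun := fun m => f l m
       map_add' := fun x y => by
         simp only [f, Pi.add_apply, add_mul, Finset.sum_add_distrib]
       map_smul' := fun c x => by
         simp only [f, Pi.smul_apply, smul_eq_mul, RingHom.id_apply, Finset.mul_sum]
         exact Finset.sum_congr rfl fun i _ => Finset.sum_congr rfl fun j _ => by ring }, rfl⟩
  obtain ⟨l, hl, m, hm, hs⟩ := Sion.exists_isSaddlePointOn (f := f) hne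
    (convex_stdSimplex ℝ ι) (isCompact_stdSimplex ℝ ι)
    (fun m _ => by
      obtain ⟨φ, hφ⟩ := hlin1 m
      rw [hφ]
      exact φ.continuous_of_finiteDimensional.lowerSemicontinuous.lowerSemicontinuousOn _)
    (fun m _ => by
      obtain ⟨φ, hφ⟩ := hlin1 m
      rw [hφ]
      exact (φ.convexOn (convex_stdSimplex ℝ ι)).quasiconvexOn)
    (convex_stdSimplex ℝ ι) hne (isCompact_stdSimplex ℝ ι)
    (fun l _ => by
      obtain ⟨φ, hφ⟩ := hlin2 l
      rw [hφ]
      exact φ.continuous_of_finiteDimensional.upperSemicontinuous.upperSemicontinuousOn _)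
    (fun l _ => by
      obtain ⟨φ, hφ⟩ := hlin2 l
      rw [hφ]
      exact (φ.concaveOn (convex_stdSimplex ℝ ι)).quasiconcaveOn)
  refine ⟨l, hl, fun i => ?_⟩
  have hsym : f m m ≤ 0 := by
    have h2 : f m m + f m m = ∑ i, ∑ j, m i * (m j * (A i j + A j i)) := by
      have : f m m = ∑ i, ∑ j, m i * (m j * A j i) := by
        simp only [f]
        rw [Finset.sum_comm]
        exact Finset.sum_congr rfl fun i _ => Finset.sum_congr rfl fun j _ => by ring
      nth_rewrite 2 [this]
      simp only [f, ← Finset.sum_add_distrib]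
      exact Finset.sum_congr rfl fun i _ => Finset.sum_congr rfl fun j _ => by ring
    have h3 : f m m + f m m ≤ 0 := by
      rw [h2]
      exact Finset.sum_nonpos fun i _ => Finset.sum_nonpos fun j _ =>
        mul_nonpos_of_nonneg_of_nonpos (hm.1 i)
          (mul_nonpos_of_nonneg_of_nonpos (hm.1 j) (hA i j))
    linarith
  have h := hs m hm (Pi.single i 1) (single_mem_stdSimplex ℝ i)
  have e : f l (Pi.single i 1) = ∑ j, l j * A i j := by
    simp only [f]
    rw [Finset.sum_eq_single i (fun k _ hk => by simp [hk]) (by simp)]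
    simp
  linarith

/-- A monotone operator on a nonempty compact convex set, continuous along segments, has a solution
of its variational inequality. -/
lemma exists_variationalInequality {P : Type*} [AddCommGroup P] [Module ℝ P] [TopologicalSpace P]
    {K : Set P} (hK : IsCompact K) (hc : Convex ℝ K) (hne : K.Nonempty) (F : P → StrongDual ℝ P)
    (hmono : ∀ x ∈ K, ∀ y ∈ K, 0 ≤ (F x - F y) (x - y))
    (hcont : ∀ x y, Continuous fun s : ℝ => F (x + s • (y - x)) (y - x)) :
    ∃ x ∈ K, ∀ y ∈ K, 0 ≤ F x (y - x) := by
  have hfin : (K ∩ ⋂ y : K, {x | F y (x : P) ≤ F y (y : P)}).Nonempty := by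
    refine hK.inter_iInter_nonempty _
      (fun y => isClosed_le (F y).continuous continuous_const) fun u => ?_
    rcases u.eq_empty_or_nonempty with rfl | hu
    · simpa using hne
    have : Nonempty u := hu.to_subtype
    -- Finite intersection property for Minty's inequalities `F y x ≤ F y y`: monotonicity says that
    -- the symmetric part of this matrix is nonpositive, and the mixed strategy `l` gives a convex
    -- combination of the test points that meets all the inequalities in question.
    obtain ⟨l, hl, h⟩ := exists_mem_stdSimplex_forall_sum_le_zero
      (fun i j : u => F (i : K) (((j : K) : P) - ((i : K) : P))) (by
        intro i j
        have := hmono _ (i : K).2 _ (j : K).2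
        simp only [_root_.sub_apply, map_sub] at this ⊢
        linarith)
    refine ⟨∑ j, l j • ((j : K) : P), hc.sum_mem (fun i _ => hl.1 i) hl.2 fun i _ => (i : K).2, ?_⟩
    simp only [Set.mem_iInter]
    intro y hy
    have h' := h ⟨y, hy⟩
    simp only [map_sub, mul_sub, Finset.sum_sub_distrib, ← Finset.sum_mul, hl.2, one_mul] at h'
    have e : F y (∑ j, l j • ((j : K) : P)) = ∑ j, l j * F y ((j : K) : P) := by
      simp [map_sum]
    change F y _ ≤ F y y
    rw [e]
    linarith
  obtain ⟨x, hx, hx'⟩ := hfin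
  simp only [Set.mem_iInter] at hx'
  refine ⟨x, hx, fun y hy => ?_⟩
  -- Minty's trick: testing with points of the segment towards `y` and letting them tend to `x`
  -- moves the evaluation of `F` from the test point to `x`.
  have hseg : ∀ s ∈ Set.Ioc (0 : ℝ) 1, 0 ≤ F (x + s • (y - x)) (y - x) := by
    intro s hs
    have hm : x + s • (y - x) ∈ K :=
      hc.add_smul_sub_mem hx hy ⟨hs.1.le, hs.2⟩
    have h := hx' ⟨_, hm⟩
    change F (x + s • (y - x)) x ≤ F (x + s • (y - x)) (x + s • (y - x)) at h
    rw [map_add, map_smul, smul_eq_mul] at h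
    have : 0 ≤ s * F (x + s • (y - x)) (y - x) := by linarith
    exact nonneg_of_mul_nonneg_right this hs.1
  have hlim : Tendsto (fun s : ℝ => F (x + s • (y - x)) (y - x)) (𝓝[>] 0)
      (𝓝 (F x (y - x))) := by
    have := ((hcont x y).tendsto 0).mono_left (nhdsWithin_le_nhds (s := Set.Ioi 0))
    simpa using this
  refine ge_of_tendsto hlim ?_
  filter_upwards [Ioc_mem_nhdsGT zero_lt_one] with s hs using hseg s hs

/-! ### Nash equilibria as solutions of a variational inequality -/

/-- The tangent line inequality, obtained from Bernoulli's inequality for `u / v`; the point `v = 0`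
needs a separate treatment. -/
lemma rpow_sub_rpow_ge {b u v : ℝ} (hb : 1 ≤ b) (hu : 0 ≤ u) (hv : 0 ≤ v) :
    b * v ^ (b - 1) * (u - v) ≤ u ^ b - v ^ b := by
  rcases hv.lt_or_eq with hv | rfl
  · have h := one_add_mul_self_le_rpow_one_add (s := u / v - 1)
      (by have : 0 ≤ u / v := by positivity
          linarith) hb
    have e : 1 + (u / v - 1) = u / v := by ring
    rw [e, Real.div_rpow hu hv.le] at h
    have hvb : 0 < v ^ b := Real.rpow_pos_of_pos hv b
    rw [le_div_iff₀ hvb] at h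
    have e2 : b * v ^ (b - 1) * (u - v) = (b * (u / v - 1)) * v ^ b := by
      rw [Real.rpow_sub_one hv.ne']; field_simp
    rw [e2]; linarith
  · rcases hb.lt_or_eq with hb | rfl
    · rw [Real.zero_rpow (by linarith : b - 1 ≠ 0), Real.zero_rpow (by linarith : b ≠ 0)]
      have := Real.rpow_nonneg hu b
      linarith
    · simp

namespace Game

variable {N H : ℕ}

lemma sum_update_eq (q : Fin N → EuclideanSpace ℝ (Fin H)) (n : Fin N)
    (x : EuclideanSpace ℝ (Fin H)) :
    ∑ m, Function.update q n x m = (∑ m, q m - q n) + x := by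
  rw [Finset.sum_update_of_mem (Finset.mem_univ n), Finset.sdiff_singleton_eq_erase,
    ← Finset.add_sum_erase _ q (Finset.mem_univ n)]
  abel

/-- Convexity in the own profile. By the tangent inequality for the price and `y h ≥ 0`, the
difference of the two sides is, in each slot, at least `p' (R h + x h) * (y h - x h) ^ 2`. -/
lemma bill_sub_ge (g : Game N H) {a b c : Fin H → ℝ} (ha : ∀ h, 0 < a h) (hb : ∀ h, 1 ≤ b h)
    (hprice : ∀ h, ∀ L : ℝ, 0 ≤ L → g.price h L = a h * L ^ b h + c h)
    (hsmooth : ∀ h, ContDiff ℝ 1 (g.price h)) {R x y : EuclideanSpace ℝ (Fin H)}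
    (hR : ∀ h, 0 ≤ R h) (hx : ∀ h, 0 ≤ x h) (hy : ∀ h, 0 ≤ y h) :
    ⟪g.billGrad x (R + x), y - x⟫ ≤ g.bill y (R + y) - g.bill x (R + x) := by
  simp only [bill, ← Finset.sum_sub_distrib, PiLp.inner_apply]
  refine Finset.sum_le_sum fun h _ => ?_
  rw [g.billGrad_apply fun h => (hsmooth h).differentiable (by norm_num)]
  have hRx : 0 ≤ R h + x h := add_nonneg (hR h) (hx h)
  have hRy : 0 ≤ R h + y h := add_nonneg (hR h) (hy h)
  simp only [PiLp.add_apply, PiLp.sub_apply, RCLike.inner_apply, conj_trivial]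
  rw [deriv_price_eq (hb h) (hprice h) (hsmooth h) hRx, hprice h _ hRx, hprice h _ hRy]
  have hk := rpow_sub_rpow_ge (hb h) hRy hRx
  have hP : 0 ≤ b h * (R h + x h) ^ (b h - 1) :=
    mul_nonneg (by linarith [hb h]) (Real.rpow_nonneg hRx _)
  have h1 := mul_le_mul_of_nonneg_right hk (mul_nonneg (ha h).le (hy h))
  have h2 := mul_nonneg (mul_nonneg hP (ha h).le) (sq_nonneg (y h - x h))
  nlinarith [h1, h2]

lemma isNash_iff (g : Game N H) {a b c : Fin H → ℝ} (ha : ∀ h, 0 < a h) (hb : ∀ h, 1 ≤ b h)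
    (hprice : ∀ h, ∀ L : ℝ, 0 ≤ L → g.price h L = a h * L ^ b h + c h)
    (hsmooth : ∀ h, ContDiff ℝ 1 (g.price h)) (hlo : ∀ n h, 0 ≤ g.lo n h)
    {q : Fin N → EuclideanSpace ℝ (Fin H)} :
    g.IsNash q ↔ q ∈ g.feasible ∧
      ∀ n, ∀ x ∈ g.actionSet n, 0 ≤ ⟪g.pseudoGrad q n, x - q n⟫ := by
  rw [IsNash, mem_feasible]
  refine and_congr_right fun hq => forall_congr' fun n => ?_
  set R := ∑ m, q m - q n with hRdef
  have hsum : ∑ m, q m = R + q n := by rw [hRdef]; abel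
  simp only [sum_update_eq, ← hRdef, pseudoGrad]
  rw [hsum]
  constructor
  · intro h x hx
    have hg := g.hasGradientAt_bill (fun h => (hsmooth h).differentiable (by norm_num)) R (q n)
    have hmin : IsMinOn (fun y => g.bill y (R + y)) (g.actionSet n) (q n) := fun y hy => h y hy
    have := hmin.localize.hasFDerivWithinAt_nonneg hg.hasFDerivAt.hasFDerivWithinAt
      (sub_mem_posTangentConeAt_of_segment_subset
        ((g.convex_actionSet n).segment_subset (hq n) hx))
    rw [InnerProductSpace.toDual_apply_apply] at this
    rwa [billGrad, show R + q n - q n = R by abel, hg.gradient]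
  · intro h x hx
    have hn : ∀ m h, 0 ≤ q m h := fun m h => (hlo m h).trans ((hq m).2 h).1
    have hR : ∀ h, 0 ≤ R h := by
      intro h
      have e : R = ∑ m ∈ Finset.univ.erase n, q m := by
        rw [hRdef, ← Finset.add_sum_erase _ q (Finset.mem_univ n)]; abel
      rw [e, WithLp.ofLp_sum, Finset.sum_apply]
      exact Finset.sum_nonneg fun m _ => hn m h
    have := g.bill_sub_ge ha hb hprice hsmooth hR (hn n) (fun h => (hlo n h).trans (hx.2 h).1)
    linarith [h x hx]

/-- The pairing of profiles of all consumers, as a continuous linear functional. -/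
noncomputable def pairing (p : Fin N → EuclideanSpace ℝ (Fin H)) :
    StrongDual ℝ (Fin N → EuclideanSpace ℝ (Fin H)) :=
  ∑ n, (innerSL ℝ (p n)).comp (ContinuousLinearMap.proj n)

lemma pairing_apply (p x : Fin N → EuclideanSpace ℝ (Fin H)) :
    pairing p x = ∑ n, ⟪p n, x n⟫ := by
  simp [pairing, _root_.sum_apply]

lemma existsUnique_isNash (hN : 2 ≤ N) {a b c : Fin H → ℝ} (ha : ∀ h, 0 < a h)
    (hb : ∀ h, 1 ≤ b h) (g : Game N H)
    (hprice : ∀ h, ∀ L : ℝ, 0 ≤ L → g.price h L = a h * L ^ b h + c h)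
    (hsmooth : ∀ h, ContDiff ℝ 1 (g.price h)) (hlo : ∀ n h, 0 ≤ g.lo n h)
    (hb' : ∀ h, b h < 3 + 4 / ((N : ℝ) - 1)) (hne : g.feasible.Nonempty) :
    ∃! q, g.IsNash q := by
  have hmono := fun {x y} => g.pseudoGrad_strictMono hN ha hb hprice hsmooth hlo hb'
    (x := x) (y := y)
  have hiff := fun {q} => g.isNash_iff ha hb hprice hsmooth hlo (q := q)
  obtain ⟨q, hq, hvi⟩ := exists_variationalInequality g.isCompact_feasible g.convex_feasible hne
    (fun x => pairing (g.pseudoGrad x))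
    (by
      intro x hx y hy
      rw [_root_.sub_apply, pairing_apply, pairing_apply, ← Finset.sum_sub_distrib]
      rcases eq_or_ne x y with rfl | hxy
      · simp
      · refine (hmono hx hy hxy).le.trans_eq (Finset.sum_congr rfl fun n _ => ?_)
        rw [inner_sub_left]; rfl)
    (by
      intro x y
      simp only [pairing_apply]
      refine continuous_finsetSum _ fun n _ => ?_
      have h1 : Continuous fun s : ℝ => g.pseudoGrad (x + s • (y - x)) n :=
        (continuous_apply n).comp ((g.continuous_pseudoGrad hsmooth).comp (by fun_prop))
      exact h1.inner continuous_const)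
  refine ⟨q, hiff.2 ⟨hq, fun n x hx => ?_⟩, fun q' hq' => ?_⟩
  · have h := hvi (Function.update q n x) (mem_feasible.2 fun m => by
      rcases eq_or_ne m n with rfl | hm
      · simpa using hx
      · simpa [hm] using mem_feasible.1 hq m)
    rw [pairing_apply, Finset.sum_eq_single n (fun m _ hm => by simp [hm]) (by simp)] at h
    simpa using h
  · by_contra hne'
    have h' := hiff.1 hq'
    have hpos := hmono h'.1 hq hne'
    have h1 : 0 ≤ ∑ n, ⟪g.pseudoGrad q n, q' n - q n⟫ := by
      simpa [pairing_apply] using hvi q' h'.1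
    have h2 : 0 ≤ ∑ n, ⟪g.pseudoGrad q' n, q n - q' n⟫ :=
      Finset.sum_nonneg fun n _ => h'.2 n _ (mem_feasible.1 hq n)
    have : ∑ n, ⟪g.pseudoGrad q' n - g.pseudoGrad q n, q' n - q n⟫ =
        -(∑ n, ⟪g.pseudoGrad q' n, q n - q' n⟫) - ∑ n, ⟪g.pseudoGrad q n, q' n - q n⟫ := by
      rw [← Finset.sum_neg_distrib, ← Finset.sum_sub_distrib]
      refine Finset.sum_congr rfl fun n _ => ?_
      rw [inner_sub_left, ← inner_neg_right, neg_sub]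
    linarith

end Game

/-! ### Order and frequencies of the clock ticks -/

lemma eq_range_card_of_lower {S : Finset ℕ} (hS : ∀ k ∈ S, ∀ k' < k, k' ∈ S) :
    S = Finset.range S.card := by
  refine Finset.eq_of_subset_of_card_le (fun k hk => ?_) (by simp)
  have hsub : Finset.range (k + 1) ⊆ S := fun k' hk' => by
    rcases (Nat.lt_succ_iff.1 (Finset.mem_range.1 hk')).lt_or_eq with h | rfl
    · exact hS k hk k' h
    · exact hk
  have := Finset.card_le_card hsub
  rw [Finset.card_range] at this
  exact Finset.mem_range.2 this

section Ticks

variable {N : ℕ} {w : Fin N → ℕ → ℝ} {σ : ℕ → Fin N × ℕ}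

/-- The number of ticks of the clock of `n` among the first `t` ticks in the order `σ`. -/
def tickCount (σ : ℕ → Fin N × ℕ) (n : Fin N) (t : ℕ) : ℕ :=
  ((Finset.range t).filter fun s => (σ s).1 = n).card

lemma IsTickOrder.injective (h : IsTickOrder w σ) : Function.Injective σ :=
  fun _ _ hst => h.1.injective (congrArg (tickTime w) hst)

/-- Positive waiting times make tick times increase along each clock, so the ticks of one clock
appear in their own order and without omissions. Counts along `σ` thereby become counts along the
i.i.d. sequences of single consumers. -/
lemma IsTickOrder.image_snd (h : IsTickOrder w σ) (hw : ∀ n k, 0 < w n k) (n : Fin N) (t : ℕ) :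
    ((Finset.range t).filter fun s => (σ s).1 = n).image (fun s => (σ s).2) =
      Finset.range (tickCount σ n t) := by
  have hinj : Set.InjOn (fun s => (σ s).2)
      ((Finset.range t).filter fun s => (σ s).1 = n : Finset ℕ) := by
    intro s hs s' hs' e
    have h1 : (σ s).1 = n := (Finset.mem_filter.1 hs).2
    have h2 : (σ s').1 = n := (Finset.mem_filter.1 hs').2
    exact h.injective (Prod.ext (h1.trans h2.symm) e)
  have hcard := Finset.card_image_of_injOn hinj
  rw [tickCount, ← hcard]
  refine eq_range_card_of_lower fun k hk k' hk' => ?_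
  obtain ⟨s, hs, rfl⟩ := Finset.mem_image.1 hk
  obtain ⟨hst, hsn⟩ := Finset.mem_filter.1 hs
  obtain ⟨s', hs'⟩ := h.2 (n, k')
  refine Finset.mem_image.2 ⟨s', Finset.mem_filter.2 ⟨?_, by rw [hs']⟩, by rw [hs']⟩
  have hlt : tickTime w (σ s') < tickTime w (σ s) := by
    have e : σ s = (n, (σ s).2) := Prod.ext hsn rfl
    rw [hs', e]
    exact Finset.sum_lt_sum_of_subset (Finset.range_subset_range.2 (by simpa using hk'.le))
      (i := (σ s).2) (Finset.mem_range.2 (Nat.lt_succ_self _))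
      (by simpa using hk') (hw _ _) fun _ _ _ => (hw _ _).le
  have := h.1.lt_iff_lt.1 hlt
  exact Finset.mem_range.2 (this.trans (Finset.mem_range.1 hst))

lemma IsTickOrder.card_filter (h : IsTickOrder w σ) (hw : ∀ n k, 0 < w n k)
    (d : Fin N → ℕ → Fin N) (n j : Fin N) (t : ℕ) :
    ((Finset.range t).filter fun s => ((σ s).1, d (σ s).1 (σ s).2) = (n, j)).card =
      ((Finset.range (tickCount σ n t)).filter fun k => d n k = j).card := by
  rw [← h.image_snd hw n t]
  symm
  have e : ((((Finset.range t).filter fun s => (σ s).1 = n).image fun s => (σ s).2).filter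
      fun k => d n k = j) =
      ((Finset.range t).filter fun s => ((σ s).1, d (σ s).1 (σ s).2) = (n, j)).image
        fun s => (σ s).2 := by
    ext k
    simp only [Finset.mem_filter, Finset.mem_image, Prod.mk.injEq]
    constructor
    · rintro ⟨⟨s, ⟨hs, hsn⟩, rfl⟩, hk⟩
      exact ⟨s, ⟨hs, hsn, by rw [hsn]; exact hk⟩, rfl⟩
    · rintro ⟨s, ⟨hs, hsn, hk⟩, rfl⟩
      exact ⟨⟨s, ⟨hs, hsn⟩, rfl⟩, by rw [hsn] at hk; exact hk⟩
  rw [e]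
  refine Finset.card_image_of_injOn fun s hs s' hs' e => ?_
  have h1 := congrArg Prod.fst (Finset.mem_filter.1 hs).2
  have h2 := congrArg Prod.fst (Finset.mem_filter.1 hs').2
  exact h.injective (Prod.ext (h1.trans h2.symm) e)

lemma IsTickOrder.mem_range_iff (h : IsTickOrder w σ) (hw : ∀ n k, 0 < w n k) {n : Fin N}
    {t k s : ℕ} (hs : σ s = (n, k)) : k < tickCount σ n t ↔ s < t := by
  rw [← Finset.mem_range, ← h.image_snd hw n t]
  simp only [Finset.mem_image, Finset.mem_filter, Finset.mem_range]
  constructor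
  · rintro ⟨s', ⟨hs't, hs'n⟩, e⟩
    have : s' = s := h.injective (by rw [hs]; exact Prod.ext hs'n e)
    rwa [← this]
  · intro hst
    exact ⟨s, ⟨hst, by rw [hs]⟩, by rw [hs]⟩

lemma IsTickOrder.tendsto_tickCount (h : IsTickOrder w σ) (hw : ∀ n k, 0 < w n k) (n : Fin N) :
    Tendsto (tickCount σ n) atTop atTop := by
  refine tendsto_atTop.2 fun k => ?_
  obtain ⟨s, hs⟩ := h.2 (n, k)
  filter_upwards [eventually_gt_atTop s] with t ht
  exact ((h.mem_range_iff hw hs).2 ht).le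

lemma sum_tickCount (σ : ℕ → Fin N × ℕ) (t : ℕ) : ∑ n, tickCount σ n t = t := by
  simp only [tickCount]
  rw [← Finset.card_eq_sum_card_fiberwise (f := fun s => (σ s).1) (t := Finset.univ)
    (by intro _ _; simp), Finset.card_range]

/-- The time of tick `t` lies between two consecutive partial sums of the waiting times of `n`, so
it is asymptotic to `m` times the tick count of `n`. As `m` is common to all clocks and the counts
add up to `t`, each clock gets the share `1 / N`. Only averages of the waiting times matter, not
their memorylessness. -/
lemma IsTickOrder.tendsto_tickCount_div (h : IsTickOrder w σ) (hw : ∀ n k, 0 < w n k) {m : ℝ}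
    (hm : 0 < m)
    (hlim : ∀ n, Tendsto (fun K : ℕ => (∑ k ∈ Finset.range K, w n k) / K) atTop (𝓝 m))
    (n : Fin N) :
    Tendsto (fun t : ℕ => (tickCount σ n t : ℝ) / t) atTop (𝓝 (1 / N)) := by
  have hT : ∀ n, Tendsto (fun t : ℕ => tickTime w (σ t) / tickCount σ n t) atTop (𝓝 m) := by
    intro n
    have hc := h.tendsto_tickCount hw n
    have h1 := (hlim n).comp hc
    have h2 : Tendsto (fun t => (∑ k ∈ Finset.range (tickCount σ n t + 1), w n k) /
        ((tickCount σ n t + 1 : ℕ) : ℝ) * (1 + 1 / (tickCount σ n t : ℝ))) atTop (𝓝 m) := by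
      have h3 := (hlim n).comp ((tendsto_add_atTop_nat 1).comp hc)
      have h4 : Tendsto (fun t => 1 + 1 / (tickCount σ n t : ℝ)) atTop (𝓝 (1 + 0)) :=
        tendsto_const_nhds.add
          (tendsto_const_nhds.div_atTop (tendsto_natCast_atTop_atTop.comp hc))
      simpa using h3.mul h4
    refine tendsto_of_tendsto_of_tendsto_of_le_of_le' h1 h2 ?_ ?_
    · filter_upwards [hc.eventually_ge_atTop 1] with t ht
      have hpos : (0 : ℝ) < tickCount σ n t := by exact_mod_cast ht
      refine div_le_div_of_nonneg_right ?_ hpos.le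
      obtain ⟨s, hs⟩ := h.2 (n, tickCount σ n t - 1)
      have hst : s < t := (h.mem_range_iff hw hs).1 (by omega)
      have := (h.1 hst).le
      simp only [hs, tickTime] at this
      rwa [Nat.sub_add_cancel ht] at this
    · filter_upwards [hc.eventually_ge_atTop 1] with t ht
      have hpos : (0 : ℝ) < tickCount σ n t := by exact_mod_cast ht
      obtain ⟨s, hs⟩ := h.2 (n, tickCount σ n t)
      have hst : t ≤ s := not_lt.1 fun hlt => lt_irrefl _ ((h.mem_range_iff hw hs).2 hlt)
      have hle : tickTime w (σ t) ≤ ∑ k ∈ Finset.range (tickCount σ n t + 1), w n k := by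
        have := h.1.monotone hst
        simpa only [hs, tickTime] using this
      rw [div_le_iff₀ hpos]
      refine hle.trans_eq ?_
      push_cast
      field_simp
  have hinv : ∀ n, Tendsto (fun t : ℕ => (tickCount σ n t : ℝ) / tickTime w (σ t)) atTop
      (𝓝 m⁻¹) := fun n => by
    simpa only [inv_div] using (hT n).inv₀ hm.ne'
  have hsum : Tendsto (fun t : ℕ => (t : ℝ) / tickTime w (σ t)) atTop (𝓝 (N * m⁻¹)) := by
    have := tendsto_finsetSum Finset.univ fun n _ => hinv n
    simp only [Finset.sum_const, Finset.card_univ, Fintype.card_fin, nsmul_eq_mul] at this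
    refine this.congr fun t => ?_
    rw [← Finset.sum_div]
    congr 1
    exact_mod_cast sum_tickCount σ t
  have hN : (N : ℝ) ≠ 0 := by
    have := n.pos
    positivity
  have := (hinv n).div hsum (by positivity)
  have e : m⁻¹ / (N * m⁻¹) = 1 / N := by field_simp
  rw [e] at this
  refine this.congr fun t => ?_
  have hTt : 0 < tickTime w (σ t) :=
    Finset.sum_pos (fun _ _ => hw _ _) (by simp)
  simp only [Pi.div_apply]
  field_simp

end Ticks

/-! ### Laws of large numbers for the random input -/

lemma integrable_id_expMeasure : Integrable (fun x : ℝ => x) (expMeasure 1) := by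
  have hG := Real.GammaIntegral_convergent (s := 2) (by norm_num)
  rw [expMeasure, gammaMeasure]
  rw [integrable_withDensity_iff (by unfold gammaPDF; fun_prop) (by simp [gammaPDF])]
  have h1 : IntegrableOn (fun x => x * (gammaPDF 1 1 x).toReal) (Set.Ioi 0) := by
    refine hG.congr_fun (fun x hx => ?_) measurableSet_Ioi
    have hx0 : (0 : ℝ) ≤ x := le_of_lt hx
    simp only [gammaPDF, gammaPDFReal, if_pos hx0]
    rw [ENNReal.toReal_ofReal (by positivity)]
    norm_num
    ring
  refine (integrableOn_iff_integrable_of_support_subset ?_).1 h1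
  intro x hx
  by_contra hx0
  apply hx
  rcases (le_of_not_gt (show ¬ 0 < x from hx0)).lt_or_eq with h | rfl
  · simp [gammaPDF_of_neg h]
  · simp

lemma ae_pos_expMeasure : ∀ᵐ x ∂(expMeasure 1), 0 < x := by
  have := isProbabilityMeasure_expMeasure (r := 1) one_pos
  have h := cdf_expMeasure_eq (r := 1) one_pos 0
  rw [cdf_eq_real] at h
  simp only [le_refl, if_true, mul_zero, neg_zero, Real.exp_zero, sub_self] at h
  rw [ae_iff]
  rw [measureReal_eq_zero_iff] at h
  convert h using 2
  ext x; simp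

section Input

variable {N : ℕ} {G : SimpleGraph (Fin N)} {Ω : Type*} [MeasurableSpace Ω] {μ : Measure Ω}
  {τ : Fin N → ℕ → Ω → ℝ} {κ : Fin N → ℕ → Ω → Fin N}

lemma IsGossipInput.ae_wait_pos (h : IsGossipInput G μ τ κ) : ∀ᵐ ω ∂μ, ∀ n k, 0 < τ n k ω := by
  refine ae_all_iff.2 fun n => ae_all_iff.2 fun k => ?_
  have := ae_pos_expMeasure
  rw [← h.wait_law n k] at this
  exact ae_of_ae_map (h.measurable_wait n k).aemeasurable this

lemma IsGossipInput.tendsto_wait [IsProbabilityMeasure μ] (h : IsGossipInput G μ τ κ) :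
    ∃ m : ℝ, 0 < m ∧ ∀ᵐ ω ∂μ, ∀ n,
      Tendsto (fun K : ℕ => (∑ k ∈ Finset.range K, τ n k ω) / K) atTop (𝓝 m) := by
  have hint : ∀ n k, Integrable (τ n k) μ := fun n k => by
    have := integrable_id_expMeasure
    rw [← h.wait_law n k] at this
    exact this.comp_measurable (h.measurable_wait n k)
  have hpos : ∀ n k, ∀ᵐ ω ∂μ, 0 < τ n k ω := fun n k => by
    filter_upwards [h.ae_wait_pos] with ω hω using hω n k
  have hmean : ∀ n k, ∫ ω, τ n k ω ∂μ = ∫ x, x ∂(expMeasure 1) := fun n k => by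
    rw [← h.wait_law n k]
    exact (integral_map (f := fun x : ℝ => x) (h.measurable_wait n k).aemeasurable
      measurable_id.aestronglyMeasurable).symm
  have hslln : ∀ᵐ ω ∂μ, ∀ n, Tendsto (fun K : ℕ => (∑ k ∈ Finset.range K, τ n k ω) / K) atTop
      (𝓝 (∫ x, x ∂(expMeasure 1))) := by
    refine ae_all_iff.2 fun n => ?_
    rw [← hmean n 0]
    refine strong_law_ae_real (fun k => τ n k) (hint n 0) (fun i j hij => ?_) fun i =>
      ⟨(h.measurable_wait n i).aemeasurable, (h.measurable_wait n 0).aemeasurable, by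
        rw [h.wait_law, h.wait_law]⟩
    have hne : ((n, i) : Fin N × ℕ) ≠ (n, j) := fun e => hij (congrArg Prod.snd e)
    exact (h.indep_ticks.indepFun hne).comp measurable_fst measurable_fst
  by_cases hN : Nonempty (Fin N)
  · obtain ⟨n⟩ := hN
    refine ⟨_, ?_, hslln⟩
    rw [← hmean n 0]
    refine lt_of_le_of_ne (integral_nonneg_of_ae ((hpos n 0).mono fun _ => le_of_lt)) fun h0 => ?_
    have h0' := (integral_eq_zero_iff_of_nonneg_ae ((hpos n 0).mono fun _ => le_of_lt)
      (hint n 0)).1 h0.symm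
    have hF : ∀ᵐ ω ∂μ, False := by
      filter_upwards [h0', hpos n 0] with ω h1 h2
      exact h2.ne' h1
    obtain ⟨_, hx⟩ := hF.exists
    exact hx
  · exact ⟨1, one_pos, ae_of_all _ fun ω n => (hN ⟨n⟩).elim⟩

lemma IsGossipInput.tendsto_contact [IsProbabilityMeasure μ] (h : IsGossipInput G μ τ κ) :
    ∀ᵐ ω ∂μ, ∀ n j, Tendsto (fun K : ℕ =>
      (((Finset.range K).filter fun k => κ n k ω = j).card : ℝ) / K) atTop
      (𝓝 ((uniformOn (G.neighborSet n)).real {j})) := by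
  refine ae_all_iff.2 fun n => ae_all_iff.2 fun j => ?_
  let f : Fin N → ℝ := Set.indicator {j} 1
  have hf : Measurable f := measurable_of_finite f
  have hm : ∀ k, Measurable fun ω => f (κ n k ω) := fun k => hf.comp (h.measurable_contact n k)
  have hlaw : ∀ k, μ.map (fun ω => f (κ n k ω)) = (uniformOn (G.neighborSet n)).map f := fun k => by
    rw [← h.contact_law n k, Measure.map_map hf (h.measurable_contact n k)]
    rfl
  have hmean : ∫ ω, f (κ n 0 ω) ∂μ = (uniformOn (G.neighborSet n)).real {j} := by
    rw [← h.contact_law n 0, ← integral_indicator_one (measurableSet_singleton j),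
      integral_map (h.measurable_contact n 0).aemeasurable hf.aestronglyMeasurable]
  rw [← hmean]
  have hslln := strong_law_ae_real (μ := μ) (fun k ω => f (κ n k ω))
    (Integrable.of_bound (hm 0).aestronglyMeasurable 1 (ae_of_all _ fun ω => by
      simp only [f, Set.indicator_apply, Pi.one_apply]
      split_ifs <;> simp))
    (fun i k hik => by
      have hne : ((n, i) : Fin N × ℕ) ≠ (n, k) := fun e => hik (congrArg Prod.snd e)
      exact (h.indep_ticks.indepFun hne).comp (hf.comp measurable_snd) (hf.comp measurable_snd))
    fun i => ⟨(hm i).aemeasurable, (hm 0).aemeasurable, by rw [hlaw, hlaw]⟩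
  filter_upwards [hslln] with ω hω
  refine hω.congr fun K => ?_
  congr 1
  simp only [f, Set.indicator_apply, Set.mem_singleton_iff, Pi.one_apply, Finset.sum_boole]

/-- The number of times before `t` at which the ordered pair `(i, j)` is selected. -/
def pairCount (pr : ℕ → Fin N × Fin N) (i j : Fin N) (t : ℕ) : ℕ :=
  ((Finset.range t).filter fun s => pr s = (i, j)).card

/-- Every ordered pair is selected with an asymptotic frequency, which is positive for the edges
of the graph. -/
def HasFrequencies (G : SimpleGraph (Fin N)) (pr : ℕ → Fin N × Fin N) : Prop :=
  ∃ r : Fin N → Fin N → ℝ, (∀ i j, 0 ≤ r i j) ∧ (∀ i j, G.Adj i j → 0 < r i j) ∧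
    ∀ i j, Tendsto (fun t : ℕ => (pairCount pr i j t : ℝ) / t) atTop (𝓝 (r i j))

/-- The frequency of `(i, j)` is the share `1 / N` of clock `i` times the probability that `i`
contacts `j`. This is all that the convergence proof needs to know about the probability space. -/
lemma IsGossipInput.ae_hasFrequencies [IsProbabilityMeasure μ] (h : IsGossipInput G μ τ κ)
    {σ : ℕ → Ω → Fin N × ℕ}
    (hσ : ∀ᵐ ω ∂μ, IsTickOrder (fun n k => τ n k ω) (fun t => σ t ω)) :
    ∀ᵐ ω ∂μ, HasFrequencies G fun s => ((σ s ω).1, κ (σ s ω).1 (σ s ω).2 ω) := by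
  obtain ⟨m, hm, hwait⟩ := h.tendsto_wait
  filter_upwards [h.ae_wait_pos, hwait, h.tendsto_contact, hσ] with ω hpos hw hc hord
  refine ⟨fun i j => (uniformOn (G.neighborSet i)).real {j} * (1 / N), fun i j => by positivity,
    fun i j hij => ?_, fun i j => ?_⟩
  · have hN : (0 : ℝ) < N := by exact_mod_cast i.pos
    refine mul_pos ?_ (by positivity)
    have hfin : (G.neighborSet i).Finite := Set.toFinite _
    have := isProbabilityMeasure_uniformOn hfin ⟨j, hij⟩
    rw [measureReal_def, ENNReal.toReal_pos_iff]
    refine ⟨pos_iff_ne_zero.2 fun h0 => ?_, measure_lt_top _ _⟩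
    rw [uniformOn_eq_zero_iff hfin] at h0
    exact (h0 ▸ (⟨hij, rfl⟩ : j ∈ G.neighborSet i ∩ {j}) : j ∈ (∅ : Set (Fin N)))
  · have h1 := (hc i j).comp (hord.tendsto_tickCount hpos i)
    have h2 := hord.tendsto_tickCount_div hpos hm hw i
    refine (h1.mul h2).congr' ?_
    filter_upwards [(hord.tendsto_tickCount hpos i).eventually_ge_atTop 1] with t ht
    have hct : (0 : ℝ) < tickCount (fun t => σ t ω) i t := by exact_mod_cast ht
    have hcard := hord.card_filter hpos (fun n k => κ n k ω) i j t
    simp only [Function.comp_apply, pairCount]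
    rw [hcard]
    field_simp

end Input

/-! ### Descent criteria and logarithmic time windows -/

/-- A nonnegative sequence whose increments are asymptotically nonpositive tends to `0` if, as long
as it exceeds `ε`, it eventually drops by a fixed amount without rising by more than `ε`. -/
lemma tendsto_zero_of_descent {f : ℕ → ℝ} (hf : ∀ t, 0 ≤ f t)
    (h : ∀ ε > 0, ∃ c > 0, ∀ᶠ t in atTop, f (t + 1) ≤ f t + ε ∧
      (ε ≤ f t → ∃ t' > t, f t' ≤ f t - c ∧ ∀ s, t ≤ s → s ≤ t' → f s ≤ f t + ε)) :
    Tendsto f atTop (𝓝 0) := by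
  have key : ∀ ε > 0, ∀ᶠ t in atTop, f t ≤ 3 * ε := by
    intro ε hε
    obtain ⟨c, hc, hev⟩ := h ε hε
    obtain ⟨T, hT⟩ := eventually_atTop.1 hev
    have hbelow : ∃ t ≥ T, f t < ε := by
      by_contra hcon
      push Not at hcon
      have hdec : ∀ k : ℕ, ∃ t ≥ T, f t ≤ f T - k * c := by
        intro k
        induction k with
        | zero => exact ⟨T, le_rfl, by simp⟩
        | succ k ih =>
          obtain ⟨t, ht, hft⟩ := ih
          obtain ⟨t', ht', hle, -⟩ := (hT t ht).2 (hcon t ht)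
          refine ⟨t', ht.trans ht'.le, ?_⟩
          push_cast
          linarith
      obtain ⟨k, hk⟩ := exists_nat_gt (f T / c)
      obtain ⟨t, -, ht⟩ := hdec k
      have : f T < k * c := (div_lt_iff₀ hc).1 hk
      linarith [hf t]
    obtain ⟨t₀, ht₀, hft₀⟩ := hbelow
    -- Checkpoints `u` with `f u ≤ 2ε`: below `ε` one step is taken, otherwise a whole descent
    -- period. Between checkpoints `f` rises by at most another `ε`.
    have hchain : ∀ k : ℕ, ∃ u ≥ t₀ + k, f u ≤ 2 * ε ∧ ∀ s, t₀ ≤ s → s ≤ u → f s ≤ 3 * ε := by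
      intro k
      induction k with
      | zero =>
        refine ⟨t₀, le_rfl, by linarith, fun s h1 h2 => ?_⟩
        rw [le_antisymm h2 h1]; linarith
      | succ k ih =>
        obtain ⟨u, hu, hfu, hs⟩ := ih
        have huT : T ≤ u := by omega
        rcases lt_or_ge (f u) ε with hlt | hge
        · have h1 := (hT u huT).1
          refine ⟨u + 1, by omega, by linarith, fun s h2 h3 => ?_⟩
          rcases Nat.le_succ_iff.1 h3 with h4 | rfl
          · exact hs s h2 h4
          · linarith
        · obtain ⟨u', hu', hle, hbd⟩ := (hT u huT).2 hge
          refine ⟨u', by omega, by linarith, fun s h2 h3 => ?_⟩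
          rcases le_total s u with h4 | h4
          · exact hs s h2 h4
          · linarith [hbd s h4 h3]
    filter_upwards [eventually_ge_atTop t₀] with t ht
    obtain ⟨u, hu, -, hs⟩ := hchain t
    exact hs t ht (by omega)
  rw [Metric.tendsto_atTop']
  intro ε hε
  obtain ⟨T, hT⟩ := eventually_atTop.1 (key (ε / 4) (by linarith))
  refine ⟨T, fun t ht => ?_⟩
  rw [Real.dist_eq, sub_zero, abs_of_nonneg (hf t)]
  linarith [hT t ht.le]

/-- The step size of consumer `n` at time `t` (`0` if `n` does not update). -/
noncomputable def stepSize {N : ℕ} (pr : ℕ → Fin N × Fin N) (n : Fin N) (t : ℕ) : ℝ :=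
  if n = (pr t).1 ∨ n = (pr t).2 then 1 / (updateCount pr n t : ℝ) else 0

/-- The end of the time window of logarithmic length `δ` that starts at `t`. -/
noncomputable def windowEnd (δ : ℝ) (t : ℕ) : ℕ := ⌈Real.exp δ * t⌉₊

section Window

variable {N : ℕ} {G : SimpleGraph (Fin N)} {pr : ℕ → Fin N × Fin N}

lemma stepSize_nonneg (n : Fin N) (t : ℕ) : 0 ≤ stepSize pr n t := by
  unfold stepSize; split_ifs <;> positivity

/-- The number of updates of consumer `n` before time `t`. -/
def pastUpdates (pr : ℕ → Fin N × Fin N) (n : Fin N) (t : ℕ) : ℕ :=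
  ((Finset.range t).filter fun s => n = (pr s).1 ∨ n = (pr s).2).card

/-- `updateCount` includes the current update, so the step sizes of `n` are 1, 1/2, 1/3, ... at the
successive updates. -/
lemma sum_stepSize (n : Fin N) (t : ℕ) :
    ∑ s ∈ Finset.range t, stepSize pr n s = (harmonic (pastUpdates pr n t) : ℝ) := by
  induction t with
  | zero => simp [pastUpdates]
  | succ t ih =>
    rw [Finset.sum_range_succ, ih]
    have hp : pastUpdates pr n (t + 1) =
        pastUpdates pr n t + if n = (pr t).1 ∨ n = (pr t).2 then 1 else 0 := by
      unfold pastUpdates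
      rw [Finset.range_add_one, Finset.filter_insert]
      split_ifs with h
      · rw [Finset.card_insert_of_notMem (by simp)]
      · simp
    have hu : updateCount pr n t = pastUpdates pr n (t + 1) := rfl
    unfold stepSize
    rw [hu, hp]
    split_ifs with h
    · rw [harmonic_succ]; push_cast; ring
    · simp

lemma pastUpdates_eq_sum (n : Fin N) (t : ℕ) :
    pastUpdates pr n t = ∑ p : Fin N × Fin N, if n = p.1 ∨ n = p.2 then pairCount pr p.1 p.2 t
      else 0 := by
  unfold pastUpdates
  rw [Finset.card_eq_sum_card_fiberwise (f := pr) (t := Finset.univ) (by intro _ _; simp)]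
  refine Finset.sum_congr rfl fun p _ => ?_
  rw [Finset.filter_filter]
  split_ifs with h
  · unfold pairCount
    congr 1
    ext s
    simp only [Finset.mem_filter, and_congr_right_iff]
    intro _
    constructor
    · rintro ⟨-, rfl⟩; rfl
    · intro hs
      rw [show pr s = p from hs]
      exact ⟨h, rfl⟩
  · rw [Finset.card_eq_zero, Finset.filter_eq_empty_iff]
    rintro s - ⟨h1, rfl⟩
    exact h h1

/-- The update frequency `p` of consumer `n` influences only the limit, through `log p`; the leading
term `log t` is the same for everybody. An edge at `n` ensures `p > 0`. -/
lemma HasFrequencies.tendsto_sum_stepSize (h : HasFrequencies G pr) (hN : 2 ≤ N)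
    (hG : G.Connected) (n : Fin N) :
    ∃ k : ℝ, Tendsto (fun t : ℕ => ∑ s ∈ Finset.range t, stepSize pr n s - Real.log t) atTop
      (𝓝 k) := by
  obtain ⟨r, hr0, hr, hlim⟩ := h
  obtain ⟨j, hj⟩ : ∃ j, G.Adj n j := by
    have : Nontrivial (Fin N) := Fin.nontrivial_iff_two_le.2 hN
    exact hG.preconnected.exists_adj_of_nontrivial n
  set p := ∑ q : Fin N × Fin N, if n = q.1 ∨ n = q.2 then r q.1 q.2 else 0 with hp
  have hp0 : 0 < p := by
    refine Finset.sum_pos' (fun q _ => ?_) ⟨(n, j), Finset.mem_univ _, ?_⟩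
    · split_ifs
      exacts [hr0 _ _, le_rfl]
    · simpa using hr n j hj
  have hE : Tendsto (fun t : ℕ => (pastUpdates pr n t : ℝ) / t) atTop (𝓝 p) := by
    have : Tendsto (fun t : ℕ => ∑ q : Fin N × Fin N,
        if n = q.1 ∨ n = q.2 then (pairCount pr q.1 q.2 t : ℝ) / t else 0) atTop (𝓝 p) := by
      refine tendsto_finsetSum _ fun q _ => ?_
      split_ifs
      exacts [hlim _ _, tendsto_const_nhds]
    refine this.congr fun t => ?_
    rw [pastUpdates_eq_sum]
    push_cast
    rw [Finset.sum_div]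
    refine Finset.sum_congr rfl fun q _ => ?_
    split_ifs <;> simp
  have hEpos : ∀ᶠ t : ℕ in atTop, (0 : ℝ) < pastUpdates pr n t := by
    filter_upwards [hE.eventually (lt_mem_nhds hp0), eventually_gt_atTop 0] with t ht ht0
    have : (0 : ℝ) < t := by exact_mod_cast ht0
    exact (div_pos_iff_of_pos_right this).1 ht
  have hEtop : Tendsto (fun t : ℕ => pastUpdates pr n t) atTop atTop := by
    have h1 := hE.pos_mul_atTop hp0 tendsto_natCast_atTop_atTop
    refine tendsto_natCast_atTop_iff.1 (h1.congr' ?_)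
    filter_upwards [eventually_gt_atTop 0] with t ht
    have : (t : ℝ) ≠ 0 := by positivity
    field_simp
  refine ⟨Real.eulerMascheroniConstant + Real.log p, ?_⟩
  have h1 := Real.tendsto_harmonic_sub_log.comp hEtop
  have h2 := (Real.continuousAt_log hp0.ne').tendsto.comp hE
  refine (h1.add h2).congr' ?_
  filter_upwards [hEpos, eventually_gt_atTop 0] with t ht ht0
  have ht0' : (t : ℝ) ≠ 0 := by positivity
  simp only [Function.comp_apply]
  rw [sum_stepSize, Real.log_div ht.ne' ht0']
  ring

lemma tendsto_windowEnd_div (δ : ℝ) :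
    Tendsto (fun t : ℕ => (windowEnd δ t : ℝ) / t) atTop (𝓝 (Real.exp δ)) :=
  (tendsto_nat_ceil_mul_div_atTop (R := ℝ) (Real.exp_pos δ).le).comp tendsto_natCast_atTop_atTop

lemma lt_windowEnd {δ : ℝ} (hδ : 0 < δ) {t : ℕ} (ht : 0 < t) : t < windowEnd δ t := by
  have h1 : (1 : ℝ) < Real.exp δ := Real.one_lt_exp_iff.2 hδ
  have h2 : (0 : ℝ) < t := by exact_mod_cast ht
  exact Nat.lt_ceil.2 (by nlinarith)

lemma tendsto_windowEnd {δ : ℝ} (hδ : 0 < δ) : Tendsto (windowEnd δ) atTop atTop := by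
  refine tendsto_atTop_mono' _ ?_ tendsto_id
  filter_upwards [eventually_gt_atTop 0] with t ht using (lt_windowEnd hδ ht).le

/-- The pair count grows from about `r * t` to about `r * exp δ * t` across the window. -/
lemma HasFrequencies.eventually_mem_window (h : HasFrequencies G pr) {i j : Fin N}
    (hij : G.Adj i j) {δ : ℝ} (hδ : 0 < δ) :
    ∀ᶠ t in atTop, ∃ s, t ≤ s ∧ s < windowEnd δ t ∧ pr s = (i, j) := by
  obtain ⟨r, -, hr, hlim⟩ := h
  have hrij := hr i j hij
  have h1 : Tendsto (fun t : ℕ => (pairCount pr i j (windowEnd δ t) : ℝ) / t) atTop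
      (𝓝 (r i j * Real.exp δ)) := by
    refine (((hlim i j).comp (tendsto_windowEnd hδ)).mul (tendsto_windowEnd_div δ)).congr' ?_
    filter_upwards [eventually_gt_atTop 0] with t ht
    have : (windowEnd δ t : ℝ) ≠ 0 := by
      have := lt_windowEnd hδ ht
      have : 0 < windowEnd δ t := by omega
      positivity
    simp only [Function.comp_apply]
    field_simp
  have hlt : r i j < r i j * Real.exp δ := lt_mul_of_one_lt_right hrij (Real.one_lt_exp_iff.2 hδ)
  filter_upwards [(hlim i j).eventually_lt h1 hlt, eventually_gt_atTop 0] with t ht ht0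
  have ht0' : (0 : ℝ) < t := by exact_mod_cast ht0
  have hc : pairCount pr i j t < pairCount pr i j (windowEnd δ t) := by
    exact_mod_cast (div_lt_div_iff_of_pos_right ht0').1 ht
  obtain ⟨s, hs, hs'⟩ := Finset.exists_mem_notMem_of_card_lt_card hc
  rw [Finset.mem_filter, Finset.mem_range] at hs hs'
  refine ⟨s, not_lt.1 fun hlt => hs' ⟨hlt, hs.2⟩, hs.1, hs.2⟩

lemma tendsto_sum_window {γ : ℕ → ℝ} {k : ℝ}
    (h : Tendsto (fun t : ℕ => ∑ s ∈ Finset.range t, γ s - Real.log t) atTop (𝓝 k))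
    {δ : ℝ} (hδ : 0 < δ) :
    Tendsto (fun t => ∑ s ∈ Finset.Ico t (windowEnd δ t), γ s) atTop (𝓝 δ) := by
  have h1 := (h.comp (tendsto_windowEnd hδ)).sub h
  have h2 := (Real.continuousAt_log (Real.exp_pos δ).ne').tendsto.comp (tendsto_windowEnd_div δ)
  have h3 := h1.add h2
  rw [sub_self, zero_add, Real.log_exp] at h3
  refine h3.congr' ?_
  filter_upwards [eventually_gt_atTop 0] with t ht
  have hlt := lt_windowEnd hδ ht
  have h4 : (windowEnd δ t : ℝ) ≠ 0 := by
    have : 0 < windowEnd δ t := by omega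
    positivity
  have h5 : (t : ℝ) ≠ 0 := by positivity
  simp only [Function.comp_apply]
  rw [Real.log_div h4 h5, ← Finset.sum_range_add_sum_Ico _ hlt.le]
  ring

lemma tendsto_zero_of_sum_sub_log {γ : ℕ → ℝ} {k : ℝ}
    (h : Tendsto (fun t : ℕ => ∑ s ∈ Finset.range t, γ s - Real.log t) atTop (𝓝 k)) :
    Tendsto γ atTop (𝓝 0) := by
  have h1 := ((tendsto_add_atTop_iff_nat 1).2 h).sub h
  have h2 : Tendsto (fun t : ℕ => Real.log (1 + 1 / (t : ℝ))) atTop (𝓝 (Real.log (1 + 0))) :=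
    (Real.continuousAt_log (by norm_num)).tendsto.comp
      (tendsto_const_nhds.add tendsto_one_div_atTop_nhds_zero_nat)
  have h3 := h1.add h2
  rw [sub_self, zero_add, add_zero, Real.log_one] at h3
  refine h3.congr' ?_
  filter_upwards [eventually_gt_atTop 0] with t ht
  have h5 : (t : ℝ) ≠ 0 := by positivity
  have e : 1 + 1 / (t : ℝ) = ((t + 1 : ℕ) : ℝ) / t := by push_cast; field_simp
  rw [e, Real.log_div (by positivity) h5, Finset.sum_range_succ]
  ring

end Window

/-- If a Lyapunov function `D` decreases along `x` by the drifts `ψ i`, weighted with step sizes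
`γ i` that all have the same logarithmic growth, up to an asymptotically negligible error, and the
total drift is positive wherever `D` is, then `D` tends to `0` along `x`. -/
lemma tendsto_zero_of_averaged_descent {ι P : Type*} [Fintype ι] [MetricSpace P] {K : Set P}
    (hK : IsCompact K) {D : P → ℝ} (hD : ContinuousOn D K) (hD0 : ∀ x ∈ K, 0 ≤ D x)
    {ψ : ι → P → ℝ} (hψ : ∀ i, ContinuousOn (ψ i) K)
    (hpos : ∀ x ∈ K, 0 < D x → 0 < ∑ i, ψ i x) {x : ℕ → P} (hx : ∀ t, x t ∈ K)
    {γ : ι → ℕ → ℝ} (hγ0 : ∀ i t, 0 ≤ γ i t)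
    (hγ : ∀ i, ∃ k, Tendsto (fun t : ℕ => ∑ s ∈ Finset.range t, γ i s - Real.log t) atTop (𝓝 k))
    {C : ℝ} (hC : 0 ≤ C) (hstep : ∀ t, dist (x t) (x (t + 1)) ≤ C * ∑ i, γ i t)
    {η : ι → ℕ → ℝ} (hη : ∀ i, Tendsto (η i) atTop (𝓝 0))
    (hdesc : ∀ t, D (x (t + 1)) ≤ D (x t) + ∑ i, γ i t * (η i t - ψ i (x t))) :
    Tendsto (fun t => D (x t)) atTop (𝓝 0) := by
  refine tendsto_zero_of_descent (fun t => hD0 _ (hx t)) fun ε hε => ?_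
  have hΨ : ContinuousOn (fun y i => ψ i y) K := continuousOn_pi.2 hψ
  -- The part of `K` where `D ≥ ε` is compact, so the total drift has a positive minimum there.
  obtain ⟨c₀, hc₀, hdrift⟩ : ∃ c₀ > 0, ∀ y ∈ K, ε ≤ D y → c₀ ≤ ∑ i, ψ i y := by
    have hcomp : IsCompact (K ∩ D ⁻¹' Set.Ici ε) :=
      hK.of_isClosed_subset (hD.preimage_isClosed_of_isClosed hK.isClosed isClosed_Ici)
        Set.inter_subset_left
    rcases (K ∩ D ⁻¹' Set.Ici ε).eq_empty_or_nonempty with he | hne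
    · exact ⟨1, one_pos, fun y hy hy' => ((he ▸ ⟨hy, hy'⟩ : y ∈ (∅ : Set P))).elim⟩
    · have hcont : ContinuousOn (fun y => ∑ i, ψ i y) (K ∩ D ⁻¹' Set.Ici ε) :=
        (continuousOn_finsetSum _ fun i _ => hψ i).mono Set.inter_subset_left
      obtain ⟨z, hz, hmin⟩ := hcomp.exists_isMinOn hne hcont
      exact ⟨_, hpos z hz.1 (hε.trans_le hz.2), fun y hy hy' => hmin ⟨hy, hy'⟩⟩
  obtain ⟨M, hM⟩ := hK.exists_bound_of_continuousOn hΨ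
  have hM0 : 0 ≤ M := (norm_nonneg _).trans (hM _ (hx 0))
  set n : ℝ := (Fintype.card ι : ℝ) with hn
  have hn0 : 0 ≤ n := by positivity
  -- Error budget for one window. `Δ` bounds both `η` and the variation of each `ψ i`; `δ` is so
  -- short that `x` moves by less than `θ`; `ρ` bounds the deviation of the accumulated step sizes
  -- from `δ`. Both errors cost at most `δ * c₀ / 4`, against a gain of `δ * c₀`.
  set Δ : ℝ := c₀ / (8 * (n + 1)) with hΔ
  have hΔ0 : 0 < Δ := by positivity
  obtain ⟨θ₁, hθ₁, hθ₁'⟩ := Metric.uniformContinuousOn_iff.1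
    (hK.uniformContinuousOn_of_continuous hΨ) Δ hΔ0
  obtain ⟨θ₂, hθ₂, hθ₂'⟩ := Metric.uniformContinuousOn_iff.1
    (hK.uniformContinuousOn_of_continuous hD) ε hε
  set θ := min θ₁ θ₂ with hθ
  have hθ0 : 0 < θ := lt_min hθ₁ hθ₂
  set δ := θ / (2 * (n * C + 1)) with hδ
  have hδ0 : 0 < δ := by positivity
  have hδθ : C * (n * (2 * δ)) < θ := by
    have e : θ = δ * (2 * (n * C + 1)) := by rw [hδ]; field_simp
    rw [e]; nlinarith
  set ρ := min δ (δ * c₀ / (4 * (n * (2 * Δ + M) + 1))) with hρ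
  have hρ0 : 0 < ρ := lt_min hδ0 (by positivity)
  refine ⟨δ * c₀ / 2, by positivity, ?_⟩
  have hW : ∀ᶠ t in atTop, ∀ i, |∑ s ∈ Finset.Ico t (windowEnd δ t), γ i s - δ| < ρ := by
    refine eventually_all.2 fun i => ?_
    obtain ⟨k, hk⟩ := hγ i
    have := (tendsto_sum_window hk hδ0).eventually (Metric.ball_mem_nhds δ hρ0)
    simpa only [Metric.mem_ball, Real.dist_eq] using this
  have hηe : ∀ᶠ t in atTop, ∀ s ≥ t, ∀ i, η i s ≤ Δ := by
    have h1 : ∀ᶠ t in atTop, ∀ i, η i t ≤ Δ := eventually_all.2 fun i =>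
      (hη i).eventually (Iic_mem_nhds hΔ0)
    exact eventually_forall_ge_atTop.2 h1
  filter_upwards [hW, hηe, eventually_gt_atTop 0] with t hWt hηt ht0
  set T := windowEnd δ t with hT
  have htT : t < T := lt_windowEnd hδ0 ht0
  have hWle : ∀ i, ∑ s ∈ Finset.Ico t T, γ i s ≤ 2 * δ := fun i => by
    have h1 := (abs_lt.1 (hWt i)).2
    have h2 : ρ ≤ δ := min_le_left _ _
    linarith
  have hdist : ∀ s, t ≤ s → s ≤ T → dist (x t) (x s) < θ := by
    intro s hts hsT
    refine lt_of_le_of_lt ?_ hδθ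
    calc dist (x t) (x s) ≤ ∑ r ∈ Finset.Ico t s, dist (x r) (x (r + 1)) :=
          dist_le_Ico_sum_dist x hts
      _ ≤ ∑ r ∈ Finset.Ico t s, C * ∑ i, γ i r := Finset.sum_le_sum fun r _ => hstep r
      _ ≤ ∑ r ∈ Finset.Ico t T, C * ∑ i, γ i r :=
          Finset.sum_le_sum_of_subset_of_nonneg (Finset.Ico_subset_Ico le_rfl hsT)
            fun r _ _ => mul_nonneg hC (Finset.sum_nonneg fun i _ => hγ0 i r)
      _ = C * ∑ i, ∑ r ∈ Finset.Ico t T, γ i r := by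
          rw [← Finset.mul_sum, Finset.sum_comm]
      _ ≤ C * ∑ _i : ι, 2 * δ :=
          mul_le_mul_of_nonneg_left (Finset.sum_le_sum fun i _ => hWle i) hC
      _ = C * (n * (2 * δ)) := by
          rw [Finset.sum_const, Finset.card_univ, nsmul_eq_mul]
  have hnear : ∀ s, t ≤ s → s ≤ T → D (x s) ≤ D (x t) + ε := by
    intro s hts hsT
    have := hθ₂' _ (hx t) _ (hx s) ((hdist s hts hsT).trans_le (min_le_right _ _))
    rw [Real.dist_eq] at this
    linarith [(abs_lt.1 this).1]
  refine ⟨hnear _ (Nat.le_succ t) htT, fun hεt => ⟨T, htT, ?_, hnear⟩⟩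
  have hψ' : ∀ s, t ≤ s → s ≤ T → ∀ i, ψ i (x t) - ψ i (x s) ≤ Δ := by
    intro s hts hsT i
    have h1 := hθ₁' _ (hx t) _ (hx s) ((hdist s hts hsT).trans_le (min_le_left _ _))
    have h2 := (dist_le_pi_dist (fun i => ψ i (x t)) (fun i => ψ i (x s)) i).trans_lt h1
    rw [Real.dist_eq] at h2
    exact (abs_lt.1 h2).2.le
  have htel : ∀ s, t ≤ s → s ≤ T →
      D (x s) ≤ D (x t) + ∑ r ∈ Finset.Ico t s, ∑ i, γ i r * (2 * Δ - ψ i (x t)) := by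
    intro s hts
    induction s, hts using Nat.le_induction with
    | base => intro _; simp
    | succ s hts ih =>
      intro hsT
      rw [Finset.sum_Ico_succ_top hts]
      have h1 := ih (by omega)
      have h2 : ∑ i, γ i s * (η i s - ψ i (x s)) ≤ ∑ i, γ i s * (2 * Δ - ψ i (x t)) := by
        refine Finset.sum_le_sum fun i _ => mul_le_mul_of_nonneg_left ?_ (hγ0 i s)
        linarith [hψ' s hts (by omega) i, hηt s hts i]
      linarith [hdesc s]
  have hψM : ∀ i, |2 * Δ - ψ i (x t)| ≤ 2 * Δ + M := fun i => by
    have h1 : ‖ψ i (x t)‖ ≤ M := (norm_le_pi_norm (fun i => ψ i (x t)) i).trans (hM _ (hx t))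
    rw [Real.norm_eq_abs] at h1
    have h2 := abs_sub (2 * Δ) (ψ i (x t))
    rw [abs_of_pos (by positivity : 0 < 2 * Δ)] at h2
    linarith
  have hsum : ∑ r ∈ Finset.Ico t T, ∑ i, γ i r * (2 * Δ - ψ i (x t)) ≤
      n * (δ * (2 * Δ)) - δ * ∑ i, ψ i (x t) + n * (ρ * (2 * Δ + M)) := by
    rw [Finset.sum_comm]
    have h1 : ∀ i, ∑ r ∈ Finset.Ico t T, γ i r * (2 * Δ - ψ i (x t)) ≤
        δ * (2 * Δ) - δ * ψ i (x t) + ρ * (2 * Δ + M) := fun i => by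
      rw [← Finset.sum_mul]
      have h2 := mul_le_mul (hWt i).le (hψM i) (abs_nonneg _) hρ0.le
      rw [← abs_mul] at h2
      have h3 := (abs_le.1 h2).2
      nlinarith
    refine (Finset.sum_le_sum fun i _ => h1 i).trans_eq ?_
    rw [Finset.sum_add_distrib, Finset.sum_sub_distrib]
    simp only [Finset.sum_const, Finset.card_univ, nsmul_eq_mul, hn]
    rw [← Finset.mul_sum]
  have hf1 : n * (δ * (2 * Δ)) ≤ δ * c₀ / 4 := by
    have e : c₀ = Δ * (8 * (n + 1)) := by rw [hΔ]; field_simp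
    rw [e]
    nlinarith [mul_pos hδ0 hΔ0, mul_nonneg hn0 (mul_pos hδ0 hΔ0).le]
  have hf2 : n * (ρ * (2 * Δ + M)) ≤ δ * c₀ / 4 := by
    have h1 : ρ ≤ δ * c₀ / (4 * (n * (2 * Δ + M) + 1)) := min_le_right _ _
    rw [le_div_iff₀ (by positivity)] at h1
    nlinarith
  have hf3 := mul_le_mul_of_nonneg_left (hdrift _ (hx t) hεt) hδ0.le
  linarith [htel T htT.le le_rfl]

/-! ### Consensus of perturbed pairwise averaging -/

section Consensus

variable {N : ℕ}

/-- The values after consumers `I` and `J` have replaced theirs by the average. -/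
noncomputable def pairAverage (I J : Fin N) (u : Fin N → ℝ) (n : Fin N) : ℝ :=
  if n = I ∨ n = J then (u I + u J) / 2 else u n

lemma sum_pairAverage (I J : Fin N) (u : Fin N → ℝ) (f : ℝ → ℝ) :
    ∑ n, f (pairAverage I J u n) =
      ∑ n, f (u n) + (2 * f ((u I + u J) / 2) - f (u I) - f (u J)) := by
  rw [← sub_eq_iff_eq_add', ← Finset.sum_sub_distrib]
  rcases eq_or_ne I J with rfl | h
  · have e : (u I + u I) / 2 = u I := by ring
    rw [e, Finset.sum_eq_zero fun n _ => ?_]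
    · ring
    · unfold pairAverage
      split_ifs with hn
      · rcases hn with rfl | rfl <;> rw [e, sub_self]
      · exact sub_self _
  · rw [← Finset.sum_subset (Finset.subset_univ {I, J}) fun n _ hn => ?_, Finset.sum_pair h]
    · simp only [pairAverage, true_or, or_true, if_true]; ring
    · have hn' : ¬ (n = I ∨ n = J) := by simpa using hn
      simp [pairAverage, hn']

/-- `N` times the variance of the values `u`. -/
noncomputable def disagreement (u : Fin N → ℝ) : ℝ :=
  ∑ n, u n ^ 2 - (∑ n, u n) ^ 2 / N

lemma disagreement_eq (hN : 0 < N) (u : Fin N → ℝ) :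
    disagreement u = ∑ n, (u n - (∑ m, u m) / N) ^ 2 := by
  have hN' : (N : ℝ) ≠ 0 := by positivity
  simp only [sub_sq, Finset.sum_add_distrib, Finset.sum_sub_distrib, disagreement,
    Finset.sum_const, Finset.card_univ, Fintype.card_fin, nsmul_eq_mul, ← Finset.sum_mul,
    ← Finset.mul_sum]
  field_simp
  ring

/-- Exact averaging keeps the sum and lowers the sum of squares by `(u I - u J) ^ 2 / 2`. The
perturbation costs `2 * N * B * d` in the squares and as much in the squared mean. -/
lemma disagreement_le {B d : ℝ} {u u' : Fin N → ℝ} (hN : 0 < N) {I J : Fin N}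
    (hu : ∀ n, |u n| ≤ B) (hu' : ∀ n, |u' n| ≤ B)
    (hd : ∀ n, |u' n - pairAverage I J u n| ≤ d) :
    disagreement u' ≤ disagreement u - (u I - u J) ^ 2 / 2 + 4 * N * B * d := by
  have hN' : (0 : ℝ) < N := by positivity
  have hB : 0 ≤ B := (abs_nonneg _).trans (hu I)
  have hd0 : 0 ≤ d := (abs_nonneg _).trans (hd I)
  have hA : ∀ n, |pairAverage I J u n| ≤ B := fun n => by
    unfold pairAverage
    split_ifs
    · have h1 := abs_le.1 (hu I)
      have h2 := abs_le.1 (hu J)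
      exact abs_le.2 ⟨by linarith, by linarith⟩
    · exact hu n
  have hsum := sum_pairAverage I J u fun x => x
  have hsq := sum_pairAverage I J u fun x => x ^ 2
  have h1 : ∑ n, u' n ^ 2 ≤ ∑ n, pairAverage I J u n ^ 2 + N * (d * (2 * B)) := by
    have : ∀ n, u' n ^ 2 ≤ pairAverage I J u n ^ 2 + d * (2 * B) := fun n => by
      have h2 : |u' n + pairAverage I J u n| ≤ 2 * B :=
        (abs_add_le _ _).trans (by linarith [hu' n, hA n])
      have h3 := mul_le_mul (hd n) h2 (abs_nonneg _) hd0
      rw [← abs_mul] at h3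
      nlinarith [(abs_le.1 h3).2]
    refine (Finset.sum_le_sum fun n _ => this n).trans_eq ?_
    rw [Finset.sum_add_distrib]
    simp
  have h2 : (∑ n, u n) ^ 2 / N ≤ (∑ n, u' n) ^ 2 / N + 2 * N * B * d := by
    have hs : ∀ {v : Fin N → ℝ}, (∀ n, |v n| ≤ B) → |∑ n, v n| ≤ N * B := fun {v} hv => by
      refine (Finset.abs_sum_le_sum_abs _ _).trans ((Finset.sum_le_sum fun n _ => hv n).trans ?_)
      simp
    have h3 : |∑ n, u n - ∑ n, u' n| ≤ N * d := by
      have e : ∑ n, u n = ∑ n, pairAverage I J u n := by rw [hsum]; ring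
      rw [e, ← Finset.sum_sub_distrib]
      refine (Finset.abs_sum_le_sum_abs _ _).trans ((Finset.sum_le_sum fun n _ => ?_).trans
        (b := ∑ _n : Fin N, d) ?_)
      · rw [abs_sub_comm]; exact hd n
      · simp
    have h4 : |∑ n, u n + ∑ n, u' n| ≤ 2 * (N * B) :=
      (abs_add_le _ _).trans (by linarith [hs hu, hs hu'])
    have h5 := mul_le_mul h3 h4 (abs_nonneg _) (by positivity)
    rw [← abs_mul] at h5
    have h6 := (abs_le.1 h5).2
    rw [div_le_iff₀ hN', add_mul, div_mul_cancel₀ _ hN'.ne']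
    nlinarith
  unfold disagreement
  nlinarith [h1, h2, hsq]

lemma disagreement_le_add_sum (hN : 0 < N) {pr : ℕ → Fin N × Fin N} {u : ℕ → Fin N → ℝ}
    {d : ℕ → ℝ} {B : ℝ} (hB : ∀ t n, |u t n| ≤ B)
    (hd : ∀ t n, |u (t + 1) n - pairAverage (pr t).1 (pr t).2 (u t) n| ≤ d t) {t s : ℕ}
    (hts : t ≤ s) :
    disagreement (u s) ≤ disagreement (u t) + 4 * N * B * ∑ k ∈ Finset.Ico t s, d k := by
  induction s, hts using Nat.le_induction with
  | base => simp
  | succ r htr ih =>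
    have h := disagreement_le hN (hB r) (hB (r + 1)) (hd r)
    rw [Finset.sum_Ico_succ_top htr, mul_add]
    nlinarith [sq_nonneg (u r (pr r).1 - u r (pr r).2)]

/-- Pigeonhole: without a gap longer than `g`, raising the level from `u i` in `N` steps of `g`
would catch a new value each time, `N + 1` values in all. -/
lemma exists_gap {u : Fin N → ℝ} {g : ℝ} (hg : 0 < g) {i j : Fin N} (hij : u i + N * g < u j) :
    ∃ α, (∃ i, u i ≤ α) ∧ (∃ j, ¬ u j ≤ α) ∧ ∀ n, ¬ u n ≤ α → α + g < u n := by
  by_contra hcon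
  push Not at hcon
  have key : ∀ k : ℕ, k ≤ N → k + 1 ≤ (Finset.univ.filter fun n => u n ≤ u i + k * g).card := by
    intro k
    induction k with
    | zero => intro _; exact Finset.card_pos.2 ⟨i, by simp⟩
    | succ k ih =>
      intro hk
      have hk' : (k : ℝ) ≤ N := by exact_mod_cast (by omega : k ≤ N)
      obtain ⟨n, hn1, hn2⟩ := hcon (u i + k * g) ⟨i, by nlinarith [Nat.cast_nonneg (α := ℝ) k]⟩
        ⟨j, by nlinarith⟩
      refine Nat.succ_le_of_lt (lt_of_le_of_lt (ih (by omega)) (Finset.card_lt_card ?_))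
      refine (Finset.ssubset_iff_of_subset fun m hm => ?_).2 ⟨n, ?_, ?_⟩
      · simp only [Finset.mem_filter, Finset.mem_univ, true_and] at hm ⊢
        push_cast
        linarith
      · simp only [Finset.mem_filter, Finset.mem_univ, true_and]
        push_cast
        linarith
      · simpa using hn1
  have h1 := key N le_rfl
  have h2 := Finset.card_le_univ (Finset.univ.filter fun n => u n ≤ u i + N * g)
  rw [Fintype.card_fin] at h2
  omega

lemma exists_adj_across {G : SimpleGraph (Fin N)} (hG : G.Connected) {S : Fin N → Prop}
    (h1 : ∃ i, S i) (h2 : ∃ j, ¬ S j) : ∃ i j, G.Adj i j ∧ S i ∧ ¬ S j := by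
  obtain ⟨i, hi⟩ := h1
  obtain ⟨j, hj⟩ := h2
  obtain ⟨p⟩ := hG.preconnected i j
  obtain ⟨d, -, hd1, hd2⟩ := p.exists_boundary_dart {n | S n} hi hj
  exact ⟨d.fst, d.snd, d.adj, hd1, hd2⟩

/-- Pairwise averaging along the edges of a connected graph, perturbed by errors `d`, decreases the
disagreement during any period in which all edges are used. -/
lemma exists_disagreement_drop {G : SimpleGraph (Fin N)} (hG : G.Connected)
    {pr : ℕ → Fin N × Fin N} {u : ℕ → Fin N → ℝ} {d : ℕ → ℝ} {B : ℝ} (hB : ∀ t n, |u t n| ≤ B)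
    (hd : ∀ t n, |u (t + 1) n - pairAverage (pr t).1 (pr t).2 (u t) n| ≤ d t)
    {t T : ℕ} (hall : ∀ i j, G.Adj i j → ∃ s, t ≤ s ∧ s < T ∧ pr s = (i, j))
    {g e : ℝ} (hg : 0 < g) (he : ∑ s ∈ Finset.Ico t T, d s ≤ e) (heg : 4 * e ≤ g)
    {i j : Fin N} (hij : u t i + N * g < u t j) :
    ∃ s, t < s ∧ s ≤ T ∧ disagreement (u s) ≤ disagreement (u t) - g ^ 2 / 8 + 4 * N * B * e := by
  classical
  have hN : 0 < N := i.pos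
  have hB0 : 0 ≤ B := (abs_nonneg _).trans (hB 0 i)
  have hd0 : ∀ s, 0 ≤ d s := fun s => (abs_nonneg _).trans (hd s i)
  have hpart : ∀ s ≤ T, ∑ r ∈ Finset.Ico t s, d r ≤ e := fun s hs =>
    (Finset.sum_le_sum_of_subset_of_nonneg (Finset.Ico_subset_Ico le_rfl hs)
      fun r _ _ => hd0 r).trans he
  obtain ⟨α, hα1, hα2, hgap⟩ := exists_gap hg hij
  obtain ⟨i', j', hadj, hi', hj'⟩ := exists_adj_across hG hα1 hα2
  -- The gap splits the consumers into a low and a high group. Before the first averaging across the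
  -- gap the groups keep apart up to the accumulated errors, and an edge joining them is used before
  -- `T`.
  let cross : ℕ → Prop := fun s => t ≤ s ∧ ¬ (u t (pr s).1 ≤ α ↔ u t (pr s).2 ≤ α)
  have hex : ∃ s, cross s ∧ s < T := by
    obtain ⟨s, hts, hsT, hs⟩ := hall i' j' hadj
    refine ⟨s, ⟨hts, ?_⟩, hsT⟩
    rw [hs]
    tauto
  have hex' : ∃ s, cross s := hex.imp fun _ h => h.1
  set s := Nat.find hex' with hs
  have hsT : s < T := by
    obtain ⟨r, hr, hrT⟩ := hex
    exact (Nat.find_min' hex' hr).trans_lt hrT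
  obtain ⟨hts, hcr⟩ : cross s := Nat.find_spec hex'
  have hinv : ∀ r, t ≤ r → r ≤ s → ∀ n,
      (u t n ≤ α → u r n ≤ α + ∑ k ∈ Finset.Ico t r, d k) ∧
      (¬ u t n ≤ α → α + g - ∑ k ∈ Finset.Ico t r, d k ≤ u r n) := by
    intro r htr
    induction r, htr using Nat.le_induction with
    | base => intro _ n; exact ⟨fun h => by simpa using h, fun h => by simpa using (hgap n h).le⟩
    | succ r htr ih =>
      intro hrs n
      have ih' := ih (by omega)
      have hnc : u t (pr r).1 ≤ α ↔ u t (pr r).2 ≤ α := by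
        by_contra h
        exact Nat.find_min hex' (show r < s by omega) ⟨htr, h⟩
      have hdn := abs_le.1 (hd r n)
      rw [Finset.sum_Ico_succ_top htr]
      unfold pairAverage at hdn
      split_ifs at hdn with hn
      · have hn' : (u t n ≤ α ↔ u t (pr r).1 ≤ α) := by
          rcases hn with rfl | rfl
          · rfl
          · exact hnc.symm
        constructor
        · intro h
          have h1 := (ih' (pr r).1).1 (hn'.1 h)
          have h2 := (ih' (pr r).2).1 (hnc.1 (hn'.1 h))
          linarith
        · intro h
          have h1 := (ih' (pr r).1).2 (fun h' => h (hn'.2 h'))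
          have h2 := (ih' (pr r).2).2 (fun h' => h (hn'.2 (hnc.2 h')))
          linarith
      · exact ⟨fun h => by linarith [(ih' n).1 h], fun h => by linarith [(ih' n).2 h]⟩
  refine ⟨s + 1, by omega, hsT, ?_⟩
  have h1 := disagreement_le hN (hB s) (hB (s + 1)) (hd s)
  have h2 := disagreement_le_add_sum hN hB hd hts
  have h3 : ∑ k ∈ Finset.Ico t s, d k + d s ≤ e := by
    rw [← Finset.sum_Ico_succ_top hts]
    exact hpart _ hsT
  have h4 := mul_le_mul_of_nonneg_left h3 (by positivity : 0 ≤ 4 * N * B)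
  have h5 : ∑ k ∈ Finset.Ico t s, d k ≤ e := hpart s hsT.le
  -- The gap has shrunk by at most `2 * e ≤ g / 2`, so this averaging gains at least `(g / 2) ^ 2 /
  -- 2 = g ^ 2 / 8`.
  have h6 : (g / 2) ^ 2 ≤ (u s (pr s).1 - u s (pr s).2) ^ 2 := by
    have hI := hinv s hts le_rfl (pr s).1
    have hJ := hinv s hts le_rfl (pr s).2
    by_cases hc : u t (pr s).1 ≤ α
    · have hc' : ¬ u t (pr s).2 ≤ α := fun h => hcr ⟨fun _ => h, fun _ => hc⟩
      have := hI.1 hc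
      have := hJ.2 hc'
      rw [← neg_sub (u s (pr s).2), neg_sq]
      exact pow_le_pow_left₀ (by linarith) (by linarith) 2
    · have hc' : u t (pr s).2 ≤ α := by
        by_contra h
        exact hcr ⟨fun h' => (hc h').elim, fun h' => (h h').elim⟩
      have := hI.2 hc
      have := hJ.1 hc'
      exact pow_le_pow_left₀ (by linarith) (by linarith) 2
  nlinarith

/-- Gossip averaging with vanishing perturbations reaches consensus. -/
lemma tendsto_consensus {G : SimpleGraph (Fin N)} (hG : G.Connected) {pr : ℕ → Fin N × Fin N}
    (hpr : HasFrequencies G pr) {u : ℕ → Fin N → ℝ} {d : ℕ → ℝ} {B : ℝ}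
    (hB : ∀ t n, |u t n| ≤ B)
    (hd : ∀ t n, |u (t + 1) n - pairAverage (pr t).1 (pr t).2 (u t) n| ≤ d t)
    (hsum : ∀ η > 0, ∃ δ > 0, ∀ᶠ t in atTop, ∑ s ∈ Finset.Ico t (windowEnd δ t), d s ≤ η)
    (n : Fin N) :
    Tendsto (fun t => u t n - (∑ m, u t m) / N) atTop (𝓝 0) := by
  have hN : 0 < N := n.pos
  have hN' : (0 : ℝ) < N := by positivity
  have hB0 : 0 ≤ B := (abs_nonneg _).trans (hB 0 n)
  have hd0 : ∀ s, 0 ≤ d s := fun s => (abs_nonneg _).trans (hd s n)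
  have hV0 : ∀ t, 0 ≤ disagreement (u t) := fun t => by
    rw [disagreement_eq hN]
    positivity
  have hV : Tendsto (fun t => disagreement (u t)) atTop (𝓝 0) := by
    refine tendsto_zero_of_descent hV0 fun ε hε => ?_
    set C : ℝ := 4 * N * B with hC
    have hC0 : 0 ≤ C := by positivity
    -- If all values were within `θ = N * g` of each other, the disagreement would be at most `N * θ
    -- ^ 2 < ε`. A disagreement of at least `ε` therefore forces the spread that yields a gap `g`.
    obtain ⟨θ, hθ, hθε⟩ : ∃ θ > 0, N * θ ^ 2 < ε := by
      refine ⟨√(ε / (2 * N)), by positivity, ?_⟩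
      rw [Real.sq_sqrt (by positivity)]
      have : N * (ε / (2 * N)) = ε / 2 := by field_simp
      linarith
    set g := θ / N with hg
    have hg0 : 0 < g := by positivity
    set η := min (g / 4) (min (g ^ 2 / (16 * (C + 1))) (ε / (C + 1))) with hη
    have hη0 : 0 < η := by positivity
    have hη1 : 4 * η ≤ g := by
      have : η ≤ g / 4 := min_le_left _ _
      linarith
    have hη2 : C * η ≤ g ^ 2 / 16 := by
      have : η ≤ g ^ 2 / (16 * (C + 1)) := (min_le_right _ _).trans (min_le_left _ _)
      rw [le_div_iff₀ (by positivity)] at this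
      nlinarith
    have hη3 : C * η ≤ ε := by
      have : η ≤ ε / (C + 1) := (min_le_right _ _).trans (min_le_right _ _)
      rw [le_div_iff₀ (by positivity)] at this
      nlinarith
    obtain ⟨δ, hδ, hev⟩ := hsum η hη0
    have hall : ∀ᶠ t in atTop, ∀ i j, G.Adj i j →
        ∃ s, t ≤ s ∧ s < windowEnd δ t ∧ pr s = (i, j) :=
      eventually_all.2 fun i => eventually_all.2 fun j => by
        by_cases hij : G.Adj i j
        · exact (hpr.eventually_mem_window hij hδ).mono fun _ h _ => h
        · exact Eventually.of_forall fun _ h => (hij h).elim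
    refine ⟨g ^ 2 / 16, by positivity, ?_⟩
    filter_upwards [hev, hall, eventually_gt_atTop 0] with t ht hallt ht0
    have htT := lt_windowEnd hδ ht0
    have hnear : ∀ s, t ≤ s → s ≤ windowEnd δ t →
        disagreement (u s) ≤ disagreement (u t) + ε := by
      intro s hts hsT
      have h1 := disagreement_le_add_sum hN hB hd hts
      have h2 : ∑ k ∈ Finset.Ico t s, d k ≤ η :=
        (Finset.sum_le_sum_of_subset_of_nonneg (Finset.Ico_subset_Ico le_rfl hsT)
          fun r _ _ => hd0 r).trans ht
      have h3 := mul_le_mul_of_nonneg_left h2 hC0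
      linarith
    refine ⟨hnear _ (Nat.le_succ t) htT, fun hεt => ?_⟩
    obtain ⟨i, j, hij⟩ : ∃ i j, u t i + N * g < u t j := by
      by_contra hcon
      push Not at hcon
      have hNg : N * g = θ := by rw [hg]; field_simp
      have h1 : ∀ n, (u t n - (∑ m, u t m) / N) ^ 2 ≤ θ ^ 2 := fun n => by
        have h2 : u t n - (∑ m, u t m) / N = (∑ m, (u t n - u t m)) / N := by
          rw [Finset.sum_sub_distrib]
          simp only [Finset.sum_const, Finset.card_univ, Fintype.card_fin, nsmul_eq_mul]
          field_simp
        rw [h2]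
        refine sq_le_sq' ?_ ?_
        · rw [le_div_iff₀ hN']
          calc -θ * N = ∑ _m : Fin N, -θ := by simp [mul_comm]
            _ ≤ _ := Finset.sum_le_sum fun m _ => by linarith [hcon n m]
        · rw [div_le_iff₀ hN']
          calc ∑ m, (u t n - u t m) ≤ ∑ _m : Fin N, θ :=
                Finset.sum_le_sum fun m _ => by linarith [hcon m n]
            _ = _ := by simp [mul_comm]
      have h3 : disagreement (u t) ≤ N * θ ^ 2 := by
        rw [disagreement_eq hN]
        refine (Finset.sum_le_sum fun n _ => h1 n).trans_eq ?_
        simp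
      linarith
    obtain ⟨s, hts, hsT, hs⟩ := exists_disagreement_drop hG hB hd hallt hg0 ht hη1 hij
    exact ⟨s, hts, by linarith, fun r h1 h2 => hnear r h1 (h2.trans hsT)⟩
  have hsq : Tendsto (fun t => (u t n - (∑ m, u t m) / N) ^ 2) atTop (𝓝 0) := by
    refine squeeze_zero (fun t => sq_nonneg _) (fun t => ?_) hV
    rw [disagreement_eq hN]
    exact Finset.single_le_sum (f := fun n => (u t n - (∑ m, u t m) / N) ^ 2)
      (fun _ _ => sq_nonneg _) (Finset.mem_univ n)
  have habs := hsq.sqrt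
  simp only [Real.sqrt_sq_eq_abs, Real.sqrt_zero] at habs
  exact (tendsto_zero_iff_abs_tendsto_zero _).2 habs

end Consensus

/-! ### Euclidean projections -/

section Projection

variable {H : ℕ} {K : Set (EuclideanSpace ℝ (Fin H))}

lemma proj_spec (hK : IsCompact K) (hne : K.Nonempty) (x : EuclideanSpace ℝ (Fin H)) :
    proj K x ∈ K ∧ ∀ z ∈ K, dist x (proj K x) ≤ dist x z := by
  refine Classical.epsilon_spec (p := fun y => y ∈ K ∧ ∀ z ∈ K, dist x y ≤ dist x z) ?_
  obtain ⟨y, hy, hmin⟩ := hK.exists_isMinOn hne (f := fun y => dist x y) (by fun_prop)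
  exact ⟨y, hy, fun z hz => hmin hz⟩

lemma norm_proj_sub_le (hK : IsCompact K) (hc : Convex ℝ K) {x z : EuclideanSpace ℝ (Fin H)}
    (hz : z ∈ K) : ‖proj K x - z‖ ≤ ‖x - z‖ := by
  obtain ⟨hp, hmin⟩ := proj_spec hK ⟨z, hz⟩ x
  have : Nonempty K := ⟨⟨z, hz⟩⟩
  have h1 : ‖x - proj K x‖ = ⨅ w : K, ‖x - w‖ := by
    refine le_antisymm (le_ciInf fun w => ?_) ?_
    · simpa only [dist_eq_norm] using hmin w w.2
    · exact ciInf_le (f := fun w : K => ‖x - w‖)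
        ⟨0, by rintro _ ⟨w, rfl⟩; exact norm_nonneg _⟩ ⟨_, hp⟩
  have h2 := (norm_eq_iInf_iff_real_inner_le_zero hc hp).1 h1 z hz
  have h3 := norm_add_sq_real (x - proj K x) (proj K x - z)
  rw [sub_add_sub_cancel] at h3
  have h4 : ⟪x - proj K x, proj K x - z⟫ = -⟪x - proj K x, z - proj K x⟫ := by
    rw [← inner_neg_right, neg_sub]
  refine (sq_le_sq₀ (norm_nonneg _) (norm_nonneg _)).1 ?_
  nlinarith [sq_nonneg ‖x - proj K x‖]

end Projection

/-! ### Estimates and profiles along the algorithm -/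

section Dynamics

variable {N H : ℕ} (g : Game N H) (q₀ : Fin N → EuclideanSpace ℝ (Fin H))
  (pr : ℕ → Fin N × Fin N)

/-- The average of the two estimates that are exchanged at time `t`. -/
noncomputable def exchanged (t : ℕ) : EuclideanSpace ℝ (Fin H) :=
  (1 / 2 : ℝ) • ((gossip g q₀ pr t).2 (pr t).1 + (gossip g q₀ pr t).2 (pr t).2)

variable {g q₀ pr}

lemma gossip_fst_succ (t : ℕ) (n : Fin N) :
    (gossip g q₀ pr (t + 1)).1 n = if n = (pr t).1 ∨ n = (pr t).2 then
      proj (g.actionSet n) ((gossip g q₀ pr t).1 n - (1 / (updateCount pr n t : ℝ)) •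
        g.billGrad ((gossip g q₀ pr t).1 n) ((N : ℝ) • exchanged g q₀ pr t))
      else (gossip g q₀ pr t).1 n := rfl

lemma gossip_snd_succ (t : ℕ) (n : Fin N) :
    (gossip g q₀ pr (t + 1)).2 n = if n = (pr t).1 ∨ n = (pr t).2 then
      exchanged g q₀ pr t + (gossip g q₀ pr (t + 1)).1 n - (gossip g q₀ pr t).1 n
      else (gossip g q₀ pr t).2 n := rfl

lemma gossip_fst_mem (hq₀ : q₀ ∈ g.feasible) (t : ℕ) : (gossip g q₀ pr t).1 ∈ g.feasible := by
  induction t with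
  | zero => exact hq₀
  | succ t ih =>
    rw [Game.mem_feasible] at *
    intro n
    rw [gossip_fst_succ]
    split_ifs
    · exact (proj_spec (g.isCompact_actionSet n) ⟨_, hq₀ n⟩ _).1
    · exact ih n

/-- The perturbations are not summable, so boundedness of the estimates needs an invariant. An
exchange between `I ∈ A` and `J ∉ A` replaces the sum over `A` by the mean of the sums over `A \
{I}` and `A ∪ {J}`, plus `(q J - q I) / 2`, which has norm at most `B`. The concave bound `k * (N -
k)` loses exactly `1` when averaged over `k - 1` and `k + 1`, which pays for that `B`. The full set
yields conservation of the sum, singletons yield bounds on the estimates. -/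
lemma norm_sum_estimate_sub_le {B : ℝ} (hB : ∀ t n, ‖(gossip g q₀ pr t).1 n‖ ≤ B) (t : ℕ)
    (A : Finset (Fin N)) :
    ‖∑ n ∈ A, ((gossip g q₀ pr t).2 n - (gossip g q₀ pr t).1 n)‖ ≤ A.card * (N - A.card) * B := by
  induction t generalizing A with
  | zero =>
    have hB0 : A.Nonempty → 0 ≤ B := fun ⟨n, _⟩ => (norm_nonneg _).trans (hB 0 n)
    have hA : (A.card : ℝ) ≤ N := by
      exact_mod_cast A.card_le_univ.trans_eq (Fintype.card_fin N)
    rcases A.eq_empty_or_nonempty with rfl | h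
    · simp
    · have : (0 : ℝ) ≤ N - A.card := by linarith
      have := hB0 h
      simp only [gossip, sub_self, Finset.sum_const_zero, norm_zero]
      positivity
  | succ t ih =>
    set q := (gossip g q₀ pr t).1
    set v := (gossip g q₀ pr t).2
    set I := (pr t).1
    set J := (pr t).2
    set w : Fin N → EuclideanSpace ℝ (Fin H) := fun n => v n - q n with hw
    -- `d` is half the difference of the two estimates: the exchange adds it to the deviation of `I`
    -- and subtracts it from that of `J`. The new gradient step cancels, as it enters profile and
    -- estimate alike.
    set d : EuclideanSpace ℝ (Fin H) := (1 / 2 : ℝ) • (w J - w I) + (1 / 2 : ℝ) • (q J - q I)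
      with hd
    have hstep : ∀ n, (gossip g q₀ pr (t + 1)).2 n - (gossip g q₀ pr (t + 1)).1 n =
        w n + ((if n = I then d else 0) - if n = J then d else 0) := by
      intro n
      by_cases h : n = I ∨ n = J
      · rw [gossip_snd_succ, if_pos h, add_sub_assoc, add_sub_assoc, sub_sub_cancel_left]
        change (1 / 2 : ℝ) • (v I + v J) + -q n = _
        by_cases h1 : n = I <;> by_cases h2 : n = J
        · rw [if_pos h1, if_pos h2, ← h1, ← h2]
          simp only [hw]
          module
        · rw [if_pos h1, if_neg h2, hd, h1]
          simp only [hw]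
          module
        · rw [if_neg h1, if_pos h2, hd, h2]
          simp only [hw]
          module
        · tauto
      · rw [gossip_snd_succ, gossip_fst_succ, if_neg h, if_neg h, if_neg fun e => h (Or.inl e),
          if_neg fun e => h (Or.inr e), sub_self, add_zero]
    simp only [hstep, Finset.sum_add_distrib, Finset.sum_sub_distrib, Finset.sum_ite_eq']
    have half : ∀ {X Y Z : EuclideanSpace ℝ (Fin H)} {a b : ℝ}, ‖X‖ ≤ a → ‖Y‖ ≤ b →
        ‖Z‖ ≤ 2 * B → ‖(1 / 2 : ℝ) • (X + Y + Z)‖ ≤ (a + b) / 2 + B := by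
      intro X Y Z a b hX hY hZ
      rw [norm_smul, Real.norm_of_nonneg (by norm_num)]
      have := norm_add₃_le (a := X) (b := Y) (c := Z)
      linarith
    have hqq : ∀ i j, ‖q i - q j‖ ≤ 2 * B := fun i j =>
      (norm_sub_le _ _).trans (by linarith [hB t i, hB t j])
    split_ifs with hI hJ hJ
    · simpa using ih A
    · have e : ∑ n ∈ A, w n + (d - 0) = (1 / 2 : ℝ) • (∑ n ∈ A.erase I, w n +
          ∑ n ∈ insert J A, w n + (q J - q I)) := by
        rw [Finset.sum_insert hJ, ← Finset.add_sum_erase _ _ hI, hd]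
        module
      rw [e]
      refine (half (ih _) (ih _) (hqq J I)).trans_eq ?_
      rw [Finset.card_insert_of_notMem hJ, Finset.card_erase_of_mem hI,
        Nat.cast_sub (Finset.card_pos.2 ⟨I, hI⟩)]
      push_cast
      ring
    · have e : ∑ n ∈ A, w n + (0 - d) = (1 / 2 : ℝ) • (∑ n ∈ A.erase J, w n +
          ∑ n ∈ insert I A, w n + (q I - q J)) := by
        rw [Finset.sum_insert hI, ← Finset.add_sum_erase _ _ hJ, hd]
        module
      rw [e]
      refine (half (ih _) (ih _) (hqq I J)).trans_eq ?_
      rw [Finset.card_insert_of_notMem hI, Finset.card_erase_of_mem hJ,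
        Nat.cast_sub (Finset.card_pos.2 ⟨J, hJ⟩)]
      push_cast
      ring
    · simpa using ih A

lemma sum_estimate_eq {B : ℝ} (hB : ∀ t n, ‖(gossip g q₀ pr t).1 n‖ ≤ B) (t : ℕ) :
    ∑ n, (gossip g q₀ pr t).2 n = ∑ n, (gossip g q₀ pr t).1 n := by
  have h := norm_sum_estimate_sub_le hB t Finset.univ
  rw [Finset.card_univ, Fintype.card_fin, sub_self, mul_zero, zero_mul,
    norm_le_zero_iff, Finset.sum_sub_distrib, sub_eq_zero] at h
  exact h

lemma norm_estimate_le {B : ℝ} (hB : ∀ t n, ‖(gossip g q₀ pr t).1 n‖ ≤ B) (t : ℕ) (n : Fin N) :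
    ‖(gossip g q₀ pr t).2 n‖ ≤ N * B := by
  have h := norm_sum_estimate_sub_le hB t {n}
  simp only [Finset.sum_singleton, Finset.card_singleton, Nat.cast_one, one_mul] at h
  have h1 := norm_sub_norm_le ((gossip g q₀ pr t).2 n) ((gossip g q₀ pr t).1 n)
  linarith [hB t n]

lemma norm_exchanged_le {B : ℝ} (hB : ∀ t n, ‖(gossip g q₀ pr t).1 n‖ ≤ B) (t : ℕ) :
    ‖(N : ℝ) • exchanged g q₀ pr t‖ ≤ N * (N * B) := by
  rw [norm_smul, Real.norm_natCast]
  refine mul_le_mul_of_nonneg_left ?_ (Nat.cast_nonneg _)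
  rw [exchanged, norm_smul, Real.norm_of_nonneg (by norm_num)]
  have := norm_add_le ((gossip g q₀ pr t).2 (pr t).1) ((gossip g q₀ pr t).2 (pr t).2)
  linarith [norm_estimate_le hB t (pr t).1, norm_estimate_le hB t (pr t).2]

lemma norm_gossip_fst_sub_le (hq₀ : q₀ ∈ g.feasible) (t : ℕ) (n : Fin N) :
    ‖(gossip g q₀ pr (t + 1)).1 n - (gossip g q₀ pr t).1 n‖ ≤ stepSize pr n t *
      ‖g.billGrad ((gossip g q₀ pr t).1 n) ((N : ℝ) • exchanged g q₀ pr t)‖ := by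
  rw [gossip_fst_succ, stepSize]
  split_ifs with h
  · refine (norm_proj_sub_le (g.isCompact_actionSet n) (g.convex_actionSet n)
      (Game.mem_feasible.1 (gossip_fst_mem hq₀ t) n)).trans_eq ?_
    rw [sub_sub_cancel_left, norm_neg, norm_smul, Real.norm_of_nonneg (by positivity)]
  · simp

lemma norm_gossip_fst_sub_sq_le (t : ℕ) (n : Fin N)
    {y : EuclideanSpace ℝ (Fin H)} (hy : y ∈ g.actionSet n) :
    ‖(gossip g q₀ pr (t + 1)).1 n - y‖ ^ 2 ≤ ‖(gossip g q₀ pr t).1 n - y‖ ^ 2 +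
      stepSize pr n t * (stepSize pr n t *
        ‖g.billGrad ((gossip g q₀ pr t).1 n) ((N : ℝ) • exchanged g q₀ pr t)‖ ^ 2 -
        2 * ⟪g.billGrad ((gossip g q₀ pr t).1 n) ((N : ℝ) • exchanged g q₀ pr t),
          (gossip g q₀ pr t).1 n - y⟫) := by
  rw [gossip_fst_succ, stepSize]
  split_ifs with h
  · refine (pow_le_pow_left₀ (norm_nonneg _) (norm_proj_sub_le (g.isCompact_actionSet n)
      (g.convex_actionSet n) hy) 2).trans_eq ?_
    rw [sub_right_comm, norm_sub_sq_real, inner_smul_right, norm_smul,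
      Real.norm_of_nonneg (by positivity), real_inner_comm]
    ring
  · simp

lemma tendsto_exchanged_sub (hN : 2 ≤ N) {G : SimpleGraph (Fin N)} (hG : G.Connected)
    (hpr : HasFrequencies G pr) {B C : ℝ} (hB : ∀ t n, ‖(gossip g q₀ pr t).1 n‖ ≤ B)
    (hC0 : 0 ≤ C) (hC : ∀ t n, ‖(gossip g q₀ pr (t + 1)).1 n - (gossip g q₀ pr t).1 n‖ ≤
      stepSize pr n t * C) :
    Tendsto (fun t => (N : ℝ) • exchanged g q₀ pr t - ∑ m, (gossip g q₀ pr t).1 m) atTop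
      (𝓝 0) := by
  have hNpos : (0 : ℝ) < N := by
    have : 0 < N := by omega
    positivity
  have hcons : ∀ (h : Fin H) n, Tendsto (fun t => (gossip g q₀ pr t).2 n h -
      (∑ m, (gossip g q₀ pr t).2 m h) / N) atTop (𝓝 0) := by
    intro h
    refine tendsto_consensus hG hpr (u := fun t n => (gossip g q₀ pr t).2 n h)
      (d := fun t => ∑ m, stepSize pr m t * C) (B := N * B)
      (fun t n => (PiLp.norm_apply_le _ h).trans (norm_estimate_le hB t n)) (fun t n => ?_)
      fun η hη => ?_
    · have hn : ((gossip g q₀ pr (t + 1)).2 n h - pairAverage (pr t).1 (pr t).2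
          (fun n => (gossip g q₀ pr t).2 n h) n) =
          ((gossip g q₀ pr (t + 1)).1 n - (gossip g q₀ pr t).1 n) h := by
        rw [gossip_snd_succ, pairAverage]
        split_ifs with hn
        · simp only [exchanged, PiLp.add_apply, PiLp.sub_apply, PiLp.smul_apply, smul_eq_mul]
          ring
        · rw [gossip_fst_succ, if_neg hn]
          simp
      rw [hn]
      refine (PiLp.norm_apply_le _ h).trans ((hC t n).trans ?_)
      exact Finset.single_le_sum (f := fun m => stepSize pr m t * C)
        (fun m _ => mul_nonneg (stepSize_nonneg m t) hC0) (Finset.mem_univ n)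
    -- Each consumer contributes eventually at most `2 * δ * C` to the perturbation in a window, so
    -- the total is at most `2 * N * C * δ ≤ η`.
    · set δ := η / (2 * (N * C + 1)) with hδ
      have hδ0 : 0 < δ := by positivity
      refine ⟨δ, hδ0, ?_⟩
      have hW : ∀ᶠ t in atTop, ∀ m, ∑ s ∈ Finset.Ico t (windowEnd δ t), stepSize pr m s ≤ 2 * δ :=
        eventually_all.2 fun m => by
          obtain ⟨k, hk⟩ := hpr.tendsto_sum_stepSize hN hG m
          exact (tendsto_sum_window hk hδ0).eventually (Iic_mem_nhds (by linarith))
      filter_upwards [hW] with t ht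
      rw [Finset.sum_comm]
      simp only [← Finset.sum_mul]
      have h1 : ∑ m, ∑ s ∈ Finset.Ico t (windowEnd δ t), stepSize pr m s ≤ N * (2 * δ) := by
        refine (Finset.sum_le_sum fun m _ => ht m).trans_eq ?_
        simp
      refine (mul_le_mul_of_nonneg_right h1 hC0).trans ?_
      have e : η = δ * (2 * (N * C + 1)) := by rw [hδ]; field_simp
      rw [e]
      nlinarith
  have hcoord : ∀ h : Fin H, Tendsto (fun t => ((N : ℝ) • exchanged g q₀ pr t -
      ∑ m, (gossip g q₀ pr t).1 m) h) atTop (𝓝 0) := by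
    intro h
    have hs := (tendsto_finsetSum Finset.univ fun n _ => (hcons h n).abs).const_mul (N : ℝ)
    simp only [abs_zero, Finset.sum_const_zero, mul_zero] at hs
    refine squeeze_zero_norm (fun t => ?_) hs
    rw [← sum_estimate_eq hB t]
    set u : Fin N → ℝ := fun n => (gossip g q₀ pr t).2 n h with hu
    have e : ((N : ℝ) • exchanged g q₀ pr t - ∑ m, (gossip g q₀ pr t).2 m) h =
        N * (((u (pr t).1 - (∑ m, u m) / N) + (u (pr t).2 - (∑ m, u m) / N)) / 2) := by
      simp only [exchanged, PiLp.sub_apply, PiLp.smul_apply, PiLp.add_apply, smul_eq_mul,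
        WithLp.ofLp_sum, Finset.sum_apply, hu]
      field_simp
      ring
    rw [e, norm_mul, Real.norm_natCast]
    refine mul_le_mul_of_nonneg_left ?_ hNpos.le
    have h1 : ∀ n, |u n - (∑ m, u m) / N| ≤ ∑ n, |u n - (∑ m, u m) / N| := fun n =>
      Finset.single_le_sum (f := fun n => |u n - (∑ m, u m) / N|)
        (fun _ _ => abs_nonneg _) (Finset.mem_univ n)
    rw [Real.norm_eq_abs, abs_div, abs_two]
    have h2 := abs_add_le (u (pr t).1 - (∑ m, u m) / N) (u (pr t).2 - (∑ m, u m) / N)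
    linarith [h1 (pr t).1, h1 (pr t).2]
  exact ((PiLp.continuous_toLp 2 fun _ : Fin H => ℝ).tendsto 0).comp
    (tendsto_pi_nhds.2 hcoord)

end Dynamics

/-! ### Convergence along a single realization -/

theorem tendsto_gossip {N H : ℕ} (hN : 2 ≤ N) {a b c : Fin H → ℝ} (ha : ∀ h, 0 < a h)
    (hb : ∀ h, 1 ≤ b h) {g : Game N H}
    (hprice : ∀ h, ∀ L : ℝ, 0 ≤ L → g.price h L = a h * L ^ b h + c h)
    (hsmooth : ∀ h, ContDiff ℝ 1 (g.price h)) (hlo : ∀ n h, 0 ≤ g.lo n h)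
    (hb' : ∀ h, b h < 3 + 4 / ((N : ℝ) - 1)) {G : SimpleGraph (Fin N)} (hG : G.Connected)
    {q₀ : Fin N → EuclideanSpace ℝ (Fin H)} (hq₀ : q₀ ∈ g.feasible) {pr : ℕ → Fin N × Fin N}
    (hpr : HasFrequencies G pr) {q : Fin N → EuclideanSpace ℝ (Fin H)} (hq : g.IsNash q) :
    Tendsto (fun t => (gossip g q₀ pr t).1) atTop (𝓝 q) := by
  obtain ⟨hqf, hvi⟩ := (g.isNash_iff ha hb hprice hsmooth hlo).1 hq
  have hx : ∀ t, (gossip g q₀ pr t).1 ∈ g.feasible := gossip_fst_mem hq₀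
  obtain ⟨B, hBf⟩ := g.isCompact_feasible.exists_bound_of_continuousOn
    (f := fun x => x) continuousOn_id
  have hBf' : ∀ x ∈ g.feasible, ∀ n, ‖x n‖ ≤ B := fun x hx n =>
    (norm_le_pi_norm x n).trans (hBf x hx)
  have hB : ∀ t n, ‖(gossip g q₀ pr t).1 n‖ ≤ B := fun t => hBf' _ (hx t)
  have hB0 : 0 ≤ B := (norm_nonneg _).trans (hBf _ hqf)
  have hN1 : (1 : ℝ) ≤ N := by exact_mod_cast (by omega : 1 ≤ N)
  -- A compact set containing both the true and the estimated arguments of the gradient, so that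
  -- consensus of the loads transfers to the gradients by uniform continuity.
  obtain ⟨S, hS, hSmem⟩ : ∃ S : Set (EuclideanSpace ℝ (Fin H) × EuclideanSpace ℝ (Fin H)),
      IsCompact S ∧ ∀ x L, ‖x‖ ≤ B → ‖L‖ ≤ N * (N * B) → (x, L) ∈ S :=
    ⟨Metric.closedBall 0 B ×ˢ Metric.closedBall 0 (N * (N * B)),
      (isCompact_closedBall _ _).prod (isCompact_closedBall _ _), fun x L hx hL =>
      ⟨mem_closedBall_zero_iff.2 hx, mem_closedBall_zero_iff.2 hL⟩⟩
  have hcont := (g.continuous_billGrad hsmooth).continuousOn (s := S)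
  obtain ⟨C, hC0, hCS⟩ : ∃ C, 0 ≤ C ∧ ∀ x L, (x, L) ∈ S → ‖g.billGrad x L‖ ≤ C := by
    obtain ⟨C, hC⟩ := hS.exists_bound_of_continuousOn hcont
    exact ⟨max C 0, le_max_right _ _, fun x L hz => (hC (x, L) hz).trans (le_max_left _ _)⟩
  have hmem : ∀ t n, ((gossip g q₀ pr t).1 n, (N : ℝ) • exchanged g q₀ pr t) ∈ S :=
    fun t n => hSmem _ _ (hB t n) (norm_exchanged_le hB t)
  have hmem' : ∀ t n, ((gossip g q₀ pr t).1 n, ∑ m, (gossip g q₀ pr t).1 m) ∈ S := fun t n => by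
    refine hSmem _ _ (hB t n) ?_
    calc ‖∑ m, (gossip g q₀ pr t).1 m‖ ≤ ∑ _m : Fin N, B := norm_sum_le_of_le _ fun m _ => hB t m
      _ = N * B := by simp
      _ ≤ N * (N * B) := le_mul_of_one_le_left (by positivity) hN1
  have hC : ∀ t n, ‖g.billGrad ((gossip g q₀ pr t).1 n) ((N : ℝ) • exchanged g q₀ pr t)‖ ≤ C :=
    fun t n => hCS _ _ (hmem t n)
  have hstep : ∀ t n, ‖(gossip g q₀ pr (t + 1)).1 n - (gossip g q₀ pr t).1 n‖ ≤
      stepSize pr n t * C := fun t n =>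
    (norm_gossip_fst_sub_le hq₀ t n).trans
      (mul_le_mul_of_nonneg_left (hC t n) (stepSize_nonneg n t))
  have hcons := tendsto_exchanged_sub hN hG hpr hB hC0 hstep
  have herr : ∀ n, Tendsto (fun t => ‖g.billGrad ((gossip g q₀ pr t).1 n)
      ((N : ℝ) • exchanged g q₀ pr t) - g.pseudoGrad (gossip g q₀ pr t).1 n‖) atTop (𝓝 0) := by
    intro n
    rw [Metric.tendsto_nhds]
    intro ε hε
    obtain ⟨θ, hθ, hθ'⟩ := Metric.uniformContinuousOn_iff.1
      (hS.uniformContinuousOn_of_continuous hcont) ε hε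
    filter_upwards [Metric.tendsto_nhds.1 hcons θ hθ] with t ht
    rw [dist_zero_right] at ht
    rw [dist_zero_right, norm_norm]
    have := hθ' _ (hmem t n) _ (hmem' t n) (by
      rw [Prod.dist_eq, dist_self, dist_eq_norm]
      exact max_lt hθ ht)
    rwa [dist_eq_norm] at this
  have hmono := fun {x y} => g.pseudoGrad_strictMono hN ha hb hprice hsmooth hlo hb'
    (x := x) (y := y)
  have hpg := g.continuous_pseudoGrad hsmooth
  have hD := tendsto_zero_of_averaged_descent g.isCompact_feasible
    (D := fun x => ∑ n, ‖x n - q n‖ ^ 2)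
    (Continuous.continuousOn (by fun_prop)) (fun x _ => by positivity)
    (ψ := fun n x => 2 * ⟪g.pseudoGrad x n, x n - q n⟫)
    (fun n => Continuous.continuousOn (by
      have h1 : Continuous fun x => g.pseudoGrad x n := (continuous_apply n).comp hpg
      have h2 : Continuous fun x : Fin N → EuclideanSpace ℝ (Fin H) => x n - q n := by fun_prop
      exact continuous_const.mul (h1.inner h2)))
    (fun x hx hpos => by
      have hne : x ≠ q := by
        rintro rfl
        simp at hpos
      have h1 := hmono hx hqf hne
      have h2 : 0 ≤ ∑ n, ⟪g.pseudoGrad q n, x n - q n⟫ :=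
        Finset.sum_nonneg fun n _ => hvi n _ (Game.mem_feasible.1 hx n)
      simp only [inner_sub_left, Finset.sum_sub_distrib] at h1
      rw [← Finset.mul_sum]
      linarith)
    hx (γ := stepSize pr) stepSize_nonneg (fun n => hpr.tendsto_sum_stepSize hN hG n) hC0
    (fun t => by
      rw [mul_comm, Finset.sum_mul]
      have hnn : ∀ m, 0 ≤ stepSize pr m t * C := fun m => mul_nonneg (stepSize_nonneg m t) hC0
      refine (dist_pi_le_iff (Finset.sum_nonneg fun m _ => hnn m)).2 fun n => ?_
      rw [dist_comm, dist_eq_norm]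
      exact (hstep t n).trans (Finset.single_le_sum (f := fun m => stepSize pr m t * C)
        (fun m _ => hnn m) (Finset.mem_univ n)))
    -- The first term is the quadratic part of the projected step. The second bounds `2 ⟪F' - F, x n
    -- - q n⟫`, with `F'` and `F` the gradients at estimated and true load, by means of `‖x n - q n‖
    -- ≤ 2 * B`.
    (η := fun n t => stepSize pr n t * C ^ 2 + 4 * B * ‖g.billGrad ((gossip g q₀ pr t).1 n)
      ((N : ℝ) • exchanged g q₀ pr t) - g.pseudoGrad (gossip g q₀ pr t).1 n‖)
    (fun n => by
      obtain ⟨k, hk⟩ := hpr.tendsto_sum_stepSize hN hG n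
      simpa using ((tendsto_zero_of_sum_sub_log hk).mul_const (C ^ 2)).add
        ((herr n).const_mul (4 * B)))
    (fun t => by
      rw [← Finset.sum_add_distrib]
      refine Finset.sum_le_sum fun n _ =>
        (norm_gossip_fst_sub_sq_le t n (Game.mem_feasible.1 hqf n)).trans ?_
      refine add_le_add le_rfl (mul_le_mul_of_nonneg_left ?_ (stepSize_nonneg n t))
      have h1 := mul_le_mul_of_nonneg_left (pow_le_pow_left₀ (norm_nonneg _) (hC t n) 2)
        (stepSize_nonneg (pr := pr) n t)
      have h2 := abs_real_inner_le_norm (g.billGrad ((gossip g q₀ pr t).1 n)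
        ((N : ℝ) • exchanged g q₀ pr t) - g.pseudoGrad (gossip g q₀ pr t).1 n)
        ((gossip g q₀ pr t).1 n - q n)
      have h3 : ‖(gossip g q₀ pr t).1 n - q n‖ ≤ 2 * B :=
        (norm_sub_le _ _).trans (by linarith [hB t n, hBf' _ hqf n])
      have h4 := h2.trans (mul_le_mul_of_nonneg_left h3 (norm_nonneg _))
      rw [inner_sub_left] at h4
      linarith [(abs_le.1 h4).1])
  refine tendsto_pi_nhds.2 fun n => tendsto_iff_norm_sub_tendsto_zero.2 ?_
  have hsq : Tendsto (fun t => ‖(gossip g q₀ pr t).1 n - q n‖ ^ 2) atTop (𝓝 0) :=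
    squeeze_zero (fun t => by positivity) (fun t => Finset.single_le_sum
      (f := fun n => ‖(gossip g q₀ pr t).1 n - q n‖ ^ 2)
      (fun _ _ => by positivity) (Finset.mem_univ n)) hD
  have := hsq.sqrt
  simpa only [Real.sqrt_sq (norm_nonneg _), Real.sqrt_zero] using this

end LoadSched

theorem proposition4 {N H : ℕ} (hN : 2 ≤ N)
    (a b c : Fin H → ℝ) (ha : ∀ h, 0 < a h) (hb : ∀ h, 1 ≤ b h) (hc : ∀ h, 0 ≤ c h)
    (g : LoadSched.Game N H)
    (hprice : ∀ h, ∀ L : ℝ, 0 ≤ L → g.price h L = a h * L ^ b h + c h)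
    -- how the price formula is continued to negative (estimated) loads is immaterial
    (hsmooth : ∀ h, ContDiff ℝ 1 (g.price h))
    (hlo : ∀ n h, 0 ≤ g.lo n h)
    (hb' : ∀ h, b h < 3 + 4 / ((N : ℝ) - 1))
    (G : SimpleGraph (Fin N)) (hG : G.Connected)
    (q₀ : Fin N → EuclideanSpace ℝ (Fin H)) (hq₀ : ∀ n, q₀ n ∈ g.actionSet n)
    {Ω : Type*} [MeasurableSpace Ω] (μ : Measure Ω) [IsProbabilityMeasure μ]
    (τ : Fin N → ℕ → Ω → ℝ) (κ : Fin N → ℕ → Ω → Fin N)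
    (hinput : LoadSched.IsGossipInput G μ τ κ)
    (σ : ℕ → Ω → Fin N × ℕ)
    (hσ : ∀ᵐ ω ∂μ, LoadSched.IsTickOrder (fun n k => τ n k ω) (fun t => σ t ω)) :
    ∃ q : Fin N → EuclideanSpace ℝ (Fin H),
      g.IsNash q ∧ (∀ q', g.IsNash q' → q' = q) ∧
        ∀ᵐ ω ∂μ, Tendsto
          (fun t => (LoadSched.gossip g q₀
            (fun s => ((σ s ω).1, κ (σ s ω).1 (σ s ω).2 ω)) t).1)
          atTop (𝓝 q) := by
  have hq₀' : q₀ ∈ g.feasible := LoadSched.Game.mem_feasible.2 hq₀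
  obtain ⟨q, hq, huniq⟩ := LoadSched.Game.existsUnique_isNash hN ha hb g hprice hsmooth hlo hb'
    ⟨q₀, hq₀'⟩
  refine ⟨q, hq, huniq, ?_⟩
  filter_upwards [hinput.ae_hasFrequencies hσ] with ω hω
  exact LoadSched.tendsto_gossip hN ha hb hprice hsmooth hlo hb' hG hq₀' hω hq
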